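/- **Setting.** Let $d\ge1$, let $B$ be the unit ball of $\mathbb R^d$ and $B_r(z)$ the ball of radius $r$ centered at $z$. Let $\{x_n\}_{n\ge0}$ be a (locally finite) random point process on $\mathbb{R}^d$ and let $\{I_n^\circ\}_n$ be random connected bounded open subsets of $\mathbb{R}^d$ (which may depend on the point process). Define the inclusions $I_n:=x_n+I_n^\circ$ (which may overlap) and $\mathcal I:=\bigcup_n I_n$. The label $n=0$ is chosen such that $I_0$ is the inclusion closest to the origin (the first such inclusion in the lexicographic order of the points $x_n$, if there are several). For $\rho>0$ let $K_{0,\rho}$ be the connected component of $\mathcal I+\rho B$ that contains $I_0$, and let $J_{0,\rho}:=\bigcup_{n: I_n\subset K_{0,\rho}}I_n$ be the corresponding cluster. **Conditions.** (H) The point process $\{x_n\}_n$ and the random set $\mathcal I$ are stationary and ergodic. (Perc$_L$), for a constant $L\ge1$: one of the following two conditions holds: - there exist $h_0,r_0>0$ such that $r_0^{d-1}\,\mathbb P[\operatorname{diam}J_{0,h_0}>r_0]\le\frac1L h_0^d$; - there exists $\delta>0$ such that almost surely all shapes $I_n^\circ$ satisfy an interior ball condition with radius $\delta$, and there exists $r_0>0$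 such that $r_0^{d-1}\limsup_{h\downarrow0}\mathbb P[\operatorname{diam}J_{0,h}>r_0]\le\frac1L\delta^d$. For $\Lambda\ge1$ we say that (Perc$_L$) holds *at scales controlled by* $\Lambda$ if the parameters can be chosen such that $r_0\ge\Lambda^{-1}$ and $h_0\le\Lambda$ (respectively $\delta\le\Lambda$). *Action radii.* The random set $\mathcal I=\mathcal I(\mathcal X)$ is said to admit action radii $R^z$ if it is a measurable function of a collection $\mathcal X=(\mathcal X_y)_{y\in\mathbb Z^d}$ of iid random elements with values in some measurable space and if, given an iid copy $\mathcal X'$ of $\mathcal X$, for every $z\in\mathbb Z^d$ there is a nonnegative $\sigma(\mathcal X,\mathcal X')$-measurable random variable $R^z$ such that almost surely $\mathcal I(\mathcal X^z)\setminus B_{R^z}(z)=\mathcal I(\mathcal X)\setminus B_{R^z}(z)$, where $\mathcal X^z_z:=\mathcal X'_z$ and $\mathcal X^z_y:=\mathcal X_y$ for $y\ne z$. **Theorem 1 (Cluster estimates in subcritical continuum percolation).** 1. There is $L_0(d,\Lambda,\kappa,C_0)<\infty$, depending only on the indicated parameters, such that the following holds. Assume that (H) holds and that (Perc$_L$) holds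 at scales controlled by $\Lambda$, for some $\Lambda,L\ge1$. Then there exists $\rho>0$ such that, whenever $\mathcal I$ admits action radii with $\mathbb P[R^z>r]\le C_0r^{-(\kappa+d)}$ for all $r>0$ and $z\in\mathbb Z^d$, for some $\kappa,C_0>0$ with $L\ge L_0(d,\Lambda,\kappa,C_0)$, there exists $C_1>0$ such that $$\mathbb P[\operatorname{diam}J_{0,\rho}>r]\le C_1r^{-\kappa}\qquad\text{for all }r>0.$$ 2. There is $L_0'(d,\Lambda,\gamma,C_0)<\infty$, depending only on the indicated parameters, such that the following holds. Assume that (H) holds, that $\mathcal I$ admits action radii with $\mathbb P[R^z>r]\le C_0\exp(-\frac1{C_0}r^\gamma)$ for all $r>0$ and $z\in\mathbb Z^d$, for some $0<\gamma<1$ and $C_0>0$, and that (Perc$_L$) holds at scales controlled by $\Lambda$ for some $\Lambda\ge1$ and some $L\ge\max\{1,L_0'(d,\Lambda,\gamma,C_0)\}$. Then there exist $\rho,C_\gamma>0$ such that $$\mathbb P[\operatorname{diam}J_{0,\rho}>r]\le C_\gamma\exp\big(-\tfrac1{C_\gamma}r^\gamma\big)\qquad\text{for all }r>0.$$ -/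

import Mathlib

universe u v

open MeasureTheory ProbabilityTheory Filter Topology Set

noncomputable section

namespace ContinuumPercolation

/-- Euclidean space of dimension `d`. -/
abbrev E (d : ℕ) : Type := EuclideanSpace ℝ (Fin d)

/-- The lattice `ℤ^d`. -/
abbrev Lattice (d : ℕ) : Type := Fin d → ℤ

/-- A lattice point seen as a point of Euclidean space. -/
def latticePoint {d : ℕ} (z : Lattice d) : E d := WithLp.toLp 2 (fun i => (z i : ℝ))

/-- A random point process `{x_n}` together with random shapes `I_n°` (connected bounded open
sets, possibly depending on the points and possibly such that the inclusions `x_n + I_n°`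
overlap). The label `0` is given to the inclusion that is closest to the origin and, among
several such inclusions, to the first one in the lexicographic order of the points `x_n`. -/
structure InclusionProcess (d : ℕ) {Ω : Type*} [MeasurableSpace Ω] (P : Measure Ω) where
  /-- the points `x_n` -/
  center : ℕ → Ω → E d
  /-- the shapes `I_n°` -/
  shape : ℕ → Ω → Set (E d)
  measurable_center : ∀ n, Measurable (center n)
  measurableSet_shape : ∀ n, MeasurableSet {p : Ω × E d | p.2 ∈ shape n p.1}
  locallyFinite : ∀ᵐ ω ∂P, ∀ r : ℝ, {n | center n ω ∈ Metric.closedBall (0 : E d) r}.Finite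
  isOpen_shape : ∀ᵐ ω ∂P, ∀ n, IsOpen (shape n ω)
  isConnected_shape : ∀ᵐ ω ∂P, ∀ n, IsConnected (shape n ω)
  isBounded_shape : ∀ᵐ ω ∂P, ∀ n, Bornology.IsBounded (shape n ω)
  zero_closest : ∀ᵐ ω ∂P, ∀ n,
    Metric.infDist (0 : E d) ((fun x => center 0 ω + x) '' shape 0 ω)
        < Metric.infDist (0 : E d) ((fun x => center n ω + x) '' shape n ω) ∨
      (Metric.infDist (0 : E d) ((fun x => center 0 ω + x) '' shape 0 ω)
          = Metric.infDist (0 : E d) ((fun x => center n ω + x) '' shape n ω) ∧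
        toLex (center 0 ω).ofLp ≤ toLex (center n ω).ofLp)

namespace InclusionProcess

variable {d : ℕ} {Ω : Type*} [MeasurableSpace Ω] {P : Measure Ω}

/-- The inclusion `I_n = x_n + I_n°`. -/
def incl (𝓘 : InclusionProcess d P) (n : ℕ) (ω : Ω) : Set (E d) :=
  (fun x => 𝓘.center n ω + x) '' 𝓘.shape n ω

/-- The random set `⋃ n, I_n`. -/
def total (𝓘 : InclusionProcess d P) (ω : Ω) : Set (E d) := ⋃ n, 𝓘.incl n ω

/-- The point process as a random counting measure. -/
def points (𝓘 : InclusionProcess d P) (ω : Ω) : Measure (E d) :=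
  Measure.sum (fun n => Measure.dirac (𝓘.center n ω))

/-- `K` is a connected component of the fattened set `⋃ n, I_n + ρ B`. -/
def IsFatComponent (𝓘 : InclusionProcess d P) (ρ : ℝ) (ω : Ω) (K : Set (E d)) : Prop :=
  ∃ x ∈ Metric.thickening ρ (𝓘.total ω),
    K = connectedComponentIn (Metric.thickening ρ (𝓘.total ω)) x

/-- The cluster `⋃ {I_n : I_n ⊆ K}` associated with a component `K`. -/
def clusterIn (𝓘 : InclusionProcess d P) (ω : Ω) (K : Set (E d)) : Set (E d) :=
  ⋃ n, ⋃ (_ : 𝓘.incl n ω ⊆ K), 𝓘.incl n ω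

/-- The cluster `J_{0,ρ}`, associated with the component that contains `I_0`. -/
def cluster₀ (𝓘 : InclusionProcess d P) (ρ : ℝ) (ω : Ω) : Set (E d) :=
  ⋃ K, ⋃ (_ : 𝓘.IsFatComponent ρ ω K ∧ 𝓘.incl 0 ω ⊆ K), 𝓘.clusterIn ω K

/-- The probability that `diam J_{0,ρ} > r` (the diameter may be infinite). -/
def clusterTail (𝓘 : InclusionProcess d P) (ρ r : ℝ) : ℝ :=
  P.real {ω | ENNReal.ofReal r < Metric.ediam (𝓘.cluster₀ ρ ω)}

end InclusionProcess

/-- A random element `Y` of a space on which the translations of `ℝ^d` act through `τ` is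
stationary and ergodic. -/
structure IsStationaryErgodic {d : ℕ} {Ω S : Type*} [MeasurableSpace Ω] [MeasurableSpace S]
    (P : Measure Ω) (τ : E d → S → S) (Y : Ω → S) : Prop where
  stationary : ∀ z, IdentDistrib (fun ω => τ z (Y ω)) Y P P
  ergodic : ∀ A : Set S, MeasurableSet A →
    (∀ z, ∀ᵐ ω ∂P, (τ z (Y ω) ∈ A ↔ Y ω ∈ A)) →
    (∀ᵐ ω ∂P, Y ω ∈ A) ∨ (∀ᵐ ω ∂P, Y ω ∉ A)

/-- Condition (H): the point process and the inclusion process are stationary and ergodic. The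
random open set `⋃ n, I_n` is identified with its indicator field: `Set (E d)` carries the
σ-algebra generated by the events that a given point belongs to the set. -/
structure ConditionH {d : ℕ} {Ω : Type*} [MeasurableSpace Ω] {P : Measure Ω}
    (𝓘 : InclusionProcess d P) : Prop where
  points : IsStationaryErgodic P
    (fun (z : E d) (m : Measure (E d)) => m.map (fun x => z + x)) 𝓘.points
  inclusions : IsStationaryErgodic P
    (fun (z : E d) (S : Set (E d)) => (fun x => z + x) '' S) 𝓘.total

/-- Interior ball condition with radius `δ`: every boundary point lies on the boundary of a ball
of radius `δ` contained in the set. -/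
def InteriorBall {d : ℕ} (δ : ℝ) (D : Set (E d)) : Prop :=
  ∀ x ∈ frontier D, ∃ y, dist x y = δ ∧ Metric.ball y δ ⊆ D

/-- The subcritical percolation condition with constant `L`, at scales controlled by `Λ`:
`h₀, δ ≤ Λ` and `r₀ ≥ 1 / Λ`. -/
def ConditionPerc {d : ℕ} {Ω : Type*} [MeasurableSpace Ω] {P : Measure Ω}
    (𝓘 : InclusionProcess d P) (Λ L : ℝ) : Prop :=
  (∃ h₀ r₀ : ℝ, 0 < h₀ ∧ h₀ ≤ Λ ∧ 1 / Λ ≤ r₀ ∧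
    r₀ ^ (d - 1) * 𝓘.clusterTail h₀ r₀ ≤ 1 / L * h₀ ^ d) ∨
  (∃ δ : ℝ, 0 < δ ∧ δ ≤ Λ ∧ (∀ᵐ ω ∂P, ∀ n, InteriorBall δ (𝓘.shape n ω)) ∧
    ∃ r₀ : ℝ, 1 / Λ ≤ r₀ ∧
      r₀ ^ (d - 1) * limsup (fun h => 𝓘.clusterTail h r₀) (𝓝[>] (0 : ℝ)) ≤ 1 / L * δ ^ d)

/-- The inclusion process is a measurable function `Φ` of an iid field `X = (X_y)_{y ∈ ℤ^d}` and
it admits action radii `R^z` at all points `z ∈ ℤ^d`, with `ℙ[R^z > r] ≤ tail r` for all `r > 0`.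
The iid copy of `X` is the second coordinate of the product of the underlying probability space
with the space of fields, and `Function.update` resamples the value at `z`. -/
def HasActionRadii {d : ℕ} {Ω : Type u} [MeasurableSpace Ω] {P : Measure Ω}
    (𝓘 : InclusionProcess d P) (tail : ℝ → ℝ) : Prop :=
  ∃ (M : Type v) (_ : MeasurableSpace M) (ν : Measure M) (_ : IsProbabilityMeasure ν)
    (X : Lattice d → Ω → M) (Φ : (Lattice d → M) → Set (E d))
    (R : Lattice d → (Lattice d → M) × (Lattice d → M) → ℝ),
    (∀ y, Measurable (X y)) ∧ (∀ y, P.map (X y) = ν) ∧ iIndepFun X P ∧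
    Measurable Φ ∧ (∀ᵐ ω ∂P, 𝓘.total ω = Φ (fun y => X y ω)) ∧
    ∀ z, Measurable (R z) ∧ (∀ p, 0 ≤ R z p) ∧
      (∀ᵐ p ∂(P.prod (Measure.infinitePi (fun _ : Lattice d => ν))),
        Φ (Function.update (fun y => X y p.1) z (p.2 z)) \
            Metric.ball (latticePoint z) (R z (fun y => X y p.1, p.2)) =
          Φ (fun y => X y p.1) \
            Metric.ball (latticePoint z) (R z (fun y => X y p.1, p.2))) ∧
      ∀ r : ℝ, 0 < r →
        (P.prod (Measure.infinitePi (fun _ : Lattice d => ν))).real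
          {p | r < R z (fun y => X y p.1, p.2)} ≤ tail r

end ContinuumPercolation

end

/-! Clusters are replaced by chains, finite sequences of points of the random set with jumps smaller
than `t` (`Link`). A chain stays in one component of the set fattened by `t`, and points of the set
in one component of the set fattened by `t / 2` are joined by a chain. So the percolation condition
at fattening `t` controls long chains, and long chains control the cluster at `ρ = t / 2`.

Initial scale (`exists_crossing_le`). A chain crossing a box of size `w` passes near one of
O((w/Δ)^(d-1)) nodes of a grid on an intermediate sphere, and from there it is long. For `w = m *
r₀`, a union bound, stationarity and the percolation condition bound the crossing probability by a
constant times `m ^ (d - 1) * Λ / L`, small when `L` is large.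

Renormalization (`Renormalizable.measure_renorm_le`). A crossing at scale `20 N w` produces
crossings at scale `w` in each of `N` separated annuli. Events in separated regions are almost
independent: resampling one site of the iid field alters a distant event only if the action radius
is large, so the covariance is at most a sum of tails of action radii
(`measure_inter_le_of_influence`). Hence `u (20 N w) ≤ (K u(w)) ^ N + N err(w)`, which propagates
the tail of `err` from a small initial value: `N = 2` for power tails, and `N` with `(20 N) ^ γ ≤ N`
for stretched exponential ones.

Conclusion. A large cluster of `I_0` forces a crossing unless a box around the origin is free of
inclusions (`crossing_or_vacant`). Vacancy obeys the same recursion, and its initial value is small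
at large scales because the random set is almost surely nonempty. -/

noncomputable section

namespace ContinuumPercolation

/-! ### Resampling of iid fields and approximate independence -/

section Resampling

variable {ι M : Type*} [MeasurableSpace M]

/-- Exchange the coordinates in `H` of two fields. -/
def swapOn (H : Set ι) [DecidablePred (· ∈ H)] (p : (ι → M) × (ι → M)) : (ι → M) × (ι → M) :=
  (fun i => if i ∈ H then p.2 i else p.1 i, fun i => if i ∈ H then p.1 i else p.2 i)

lemma measurable_swapOn (H : Set ι) [DecidablePred (· ∈ H)] :
    Measurable (swapOn H : (ι → M) × (ι → M) → _) := by
  unfold swapOn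
  refine Measurable.prodMk (measurable_pi_lambda _ fun i => ?_) (measurable_pi_lambda _ fun i => ?_)
  all_goals split_ifs <;> fun_prop

variable (ν : Measure M) [IsProbabilityMeasure ν]

lemma map_swapOn (H : Set ι) [DecidablePred (· ∈ H)] :
    ((Measure.infinitePi fun _ : ι => ν).prod (Measure.infinitePi fun _ : ι => ν)).map (swapOn H) =
      (Measure.infinitePi fun _ : ι => ν).prod (Measure.infinitePi fun _ : ι => ν) := by
  classical
  set μ := Measure.infinitePi fun _ : ι => ν
  let C : Set (Set (ι → M)) := squareCylinders fun _ => {s | MeasurableSet s}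
  have hgen : MeasurableSpace.generateFrom C = MeasurableSpace.pi := generateFrom_squareCylinders
  have hpi : IsPiSystem C :=
    isPiSystem_squareCylinders (fun _ => MeasurableSpace.isPiSystem_measurableSet)
      (fun _ => MeasurableSet.univ)
  let hspan : μ.FiniteSpanningSetsIn C :=
    ⟨fun _ => univ, fun _ => ⟨∅, fun _ => univ, by simp, by simp⟩,
      fun _ => measure_lt_top _ _, iUnion_const _⟩
  symm
  refine Measure.prod_eq_generateFrom hgen hgen hpi hpi hspan hspan ?_
  rintro _ ⟨s₁, t₁, h₁, rfl⟩ _ ⟨s₂, t₂, h₂, rfl⟩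
  have m₁ : ∀ i, MeasurableSet (t₁ i) := fun i => h₁ i (mem_univ i)
  have m₂ : ∀ i, MeasurableSet (t₂ i) := fun i => h₂ i (mem_univ i)
  -- Padding with `univ` puts both cylinders on the common index set `s₁ ∪ s₂`, where swapping
  -- coordinates just swaps factors of the product.
  let T₁ : ι → Set M := fun i => if i ∈ s₁ then t₁ i else univ
  let T₂ : ι → Set M := fun i => if i ∈ s₂ then t₂ i else univ
  have n₁ : ∀ i, MeasurableSet (T₁ i) := fun i => by
    simp only [T₁]; split_ifs; exacts [m₁ i, MeasurableSet.univ]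
  have n₂ : ∀ i, MeasurableSet (T₂ i) := fun i => by
    simp only [T₂]; split_ifs; exacts [m₂ i, MeasurableSet.univ]
  have e₁ : (s₁ : Set ι).pi t₁ = ((s₁ ∪ s₂ : Finset ι) : Set ι).pi T₁ := by
    ext y
    simp only [Set.mem_pi, Finset.mem_coe, Finset.mem_union, T₁]
    refine ⟨fun h i _ => ?_, fun h i hi => ?_⟩
    · split_ifs with hi
      exacts [h i hi, mem_univ _]
    · simpa [hi] using h i (Or.inl hi)
  have e₂ : (s₂ : Set ι).pi t₂ = ((s₁ ∪ s₂ : Finset ι) : Set ι).pi T₂ := by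
    ext y
    simp only [Set.mem_pi, Finset.mem_coe, Finset.mem_union, T₂]
    refine ⟨fun h i _ => ?_, fun h i hi => ?_⟩
    · split_ifs with hi
      exacts [h i hi, mem_univ _]
    · simpa [hi] using h i (Or.inr hi)
  rw [e₁, e₂]
  set s := s₁ ∪ s₂
  have hm : ∀ T : ι → Set M, (∀ i, MeasurableSet (T i)) → MeasurableSet ((s : Set ι).pi T) :=
    fun T hT => MeasurableSet.pi s.countable_toSet fun i _ => hT i
  rw [Measure.map_apply (measurable_swapOn H) ((hm _ n₁).prod (hm _ n₂))]
  have : swapOn H ⁻¹' ((s : Set ι).pi T₁ ×ˢ (s : Set ι).pi T₂) =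
      ((s : Set ι).pi fun i => if i ∈ H then T₂ i else T₁ i) ×ˢ
        ((s : Set ι).pi fun i => if i ∈ H then T₁ i else T₂ i) := by
    ext p
    simp only [swapOn, mem_preimage, mem_prod, Set.mem_pi, ← forall_and]
    refine forall_congr' fun i => forall_congr' fun _ => ?_
    split_ifs <;> tauto
  rw [this, Measure.prod_prod, Measure.infinitePi_pi, Measure.infinitePi_pi, Measure.infinitePi_pi,
    Measure.infinitePi_pi, ← Finset.prod_mul_distrib, ← Finset.prod_mul_distrib]
  · refine Finset.prod_congr rfl fun i _ => ?_
    split_ifs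
    · exact mul_comm _ _
    · rfl
  · exact fun i _ => n₂ i
  · exact fun i _ => n₁ i
  · intro i _; split_ifs; exacts [n₁ i, n₂ i]
  · intro i _; split_ifs; exacts [n₂ i, n₁ i]

/-- The probability that resampling the coordinate `z` changes whether the event `F` occurs. -/
def influence [DecidableEq ι] (F : Set (ι → M)) (z : ι) : ENNReal :=
  ((Measure.infinitePi fun _ : ι => ν).prod (Measure.infinitePi fun _ : ι => ν))
    {p | ¬ (p.1 ∈ F ↔ Function.update p.1 z (p.2 z) ∈ F)}

lemma measurableSet_not_iff {α β : Type*} [MeasurableSpace α] [MeasurableSpace β] {f g : α → β}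
    (hf : Measurable f) (hg : Measurable g) {F : Set β} (hF : MeasurableSet F) :
    MeasurableSet {p | ¬ (f p ∈ F ↔ g p ∈ F)} := by
  have : {p | ¬ (f p ∈ F ↔ g p ∈ F)} = (f ⁻¹' F \ g ⁻¹' F) ∪ (g ⁻¹' F \ f ⁻¹' F) := by
    ext p; simp only [mem_ofPred_eq, mem_union, Set.mem_sdiff, mem_preimage]; tauto
  rw [this]
  exact ((hf hF).diff (hg hF)).union ((hg hF).diff (hf hF))

lemma measurable_resample [DecidableEq ι] (z : ι) :
    Measurable fun p : (ι → M) × (ι → M) => Function.update p.1 z (p.2 z) := by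
  refine measurable_pi_lambda _ fun i => ?_
  rcases eq_or_ne i z with rfl | h
  · simp only [Function.update_self]; fun_prop
  · simp only [Function.update_of_ne h]; fun_prop

/-- Telescoping: coordinates are swapped one at a time. The pair obtained after each swap still has
the product law, so the next swap costs exactly one `influence`. -/
lemma measure_swapOn_finset_le [DecidableEq ι] {F : Set (ι → M)} (hF : MeasurableSet F)
    (s : Finset ι) :
    ((Measure.infinitePi fun _ : ι => ν).prod (Measure.infinitePi fun _ : ι => ν))
      {p | ¬ (p.1 ∈ F ↔ (swapOn (s : Set ι) p).1 ∈ F)} ≤ ∑ z ∈ s, influence ν F z := by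
  induction s using Finset.induction_on with
  | empty => simp [swapOn]
  | insert z s hz ih =>
    rw [Finset.sum_insert hz]
    set μμ := (Measure.infinitePi fun _ : ι => ν).prod (Measure.infinitePi fun _ : ι => ν)
    have key : ∀ p : (ι → M) × (ι → M), (swapOn ((insert z s : Finset ι) : Set ι) p).1 =
        Function.update (swapOn (s : Set ι) p).1 z ((swapOn (s : Set ι) p).2 z) := by
      intro p
      ext i
      rcases eq_or_ne i z with rfl | h
      · simp [swapOn, hz]
      · simp [swapOn, h]
    have h1 : μμ {p | ¬ ((swapOn (s : Set ι) p).1 ∈ F ↔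
        (swapOn ((insert z s : Finset ι) : Set ι) p).1 ∈ F)} = influence ν F z := by
      have := measurableSet_not_iff measurable_fst (measurable_resample (M := M) z) hF
      rw [influence, ← map_swapOn ν (s : Set ι),
        Measure.map_apply (measurable_swapOn _) this]
      simp only [key]
      rfl
    refine (measure_mono (t := {p | ¬ ((swapOn (s : Set ι) p).1 ∈ F ↔
        (swapOn ((insert z s : Finset ι) : Set ι) p).1 ∈ F)} ∪
        {p | ¬ (p.1 ∈ F ↔ (swapOn (s : Set ι) p).1 ∈ F)}) ?_).trans
      ((measure_union_le _ _).trans (add_le_add h1.le ih))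
    intro p
    simp only [mem_ofPred_eq, mem_union]
    tauto

lemma exists_cylinder_approx {F : Set (ι → M)} (hF : MeasurableSet F) {ε : ENNReal} (hε : 0 < ε) :
    ∃ (G : Set (ι → M)) (s : Finset ι), MeasurableSet G ∧
      (∀ y y' : ι → M, (∀ i ∈ s, y i = y' i) → (y ∈ G ↔ y' ∈ G)) ∧
      (Measure.infinitePi fun _ : ι => ν) {y | ¬ (y ∈ F ↔ y ∈ G)} < ε := by
  have hring : IsSetRing (measurableCylinders fun _ : ι => M) :=
    ⟨empty_mem_measurableCylinders _, fun _ _ hs ht => union_mem_measurableCylinders hs ht,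
      fun _ _ hs ht => sdiff_mem_measurableCylinders hs ht⟩
  obtain ⟨G, hG, hFG⟩ := exists_measure_symmDiff_lt_of_generateFrom_isSetRing
    (μ := Measure.infinitePi fun _ : ι => ν) hring
    ⟨{univ}, countable_singleton _, by simpa using univ_mem_measurableCylinders fun _ : ι => M, by simp⟩
    generateFrom_measurableCylinders.symm hF hε
  obtain ⟨s, S, hS, rfl⟩ := (mem_measurableCylinders _).1 hG
  refine ⟨_, s, MeasurableSet.of_mem_measurableCylinders hG, fun y y' h => ?_, ?_⟩
  · have : s.restrict y = s.restrict y' := by ext i; exact h i i.2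
    simp only [mem_cylinder, this]
  · refine lt_of_le_of_lt (measure_mono fun y hy => ?_) hFG
    simp only [mem_ofPred_eq, symmDiff_def, sup_eq_union, mem_union, Set.mem_sdiff] at hy ⊢
    tauto

/-- Passage to infinite `H`: `F` is approximated by a cylinder `G` over a finite `s`, for which
swapping on `H` and on `H ∩ s` is the same. The approximation error is paid twice, hence `ε / 2`. -/
lemma measure_swapOn_le [DecidableEq ι] {F : Set (ι → M)} (hF : MeasurableSet F) (H : Set ι)
    [DecidablePred (· ∈ H)] :
    ((Measure.infinitePi fun _ : ι => ν).prod (Measure.infinitePi fun _ : ι => ν))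
      {p | ¬ (p.1 ∈ F ↔ (swapOn H p).1 ∈ F)} ≤ ∑' z : H, influence ν F z := by
  refine ENNReal.le_of_forall_pos_le_add fun ε hε _ => ?_
  obtain ⟨G, s, hG, hs, hFG⟩ := exists_cylinder_approx ν hF (ε := (ε : ENNReal) / 2)
    (ENNReal.half_pos (by exact_mod_cast hε.ne'))
  set μ := Measure.infinitePi fun _ : ι => ν
  let s' : Finset ι := s.filter (· ∈ H)
  have hagree : ∀ p : (ι → M) × (ι → M),
      ((swapOn (s' : Set ι) p).1 ∈ G ↔ (swapOn H p).1 ∈ G) := by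
    refine fun p => hs _ _ fun i hi => ?_
    simp [swapOn, s', hi]
  have hlaw : ∀ (K : Set ι) [DecidablePred (· ∈ K)],
      (μ.prod μ) {p | ¬ ((swapOn K p).1 ∈ F ↔ (swapOn K p).1 ∈ G)} ≤ (ε : ENNReal) / 2 := by
    intro K _
    have hm : MeasurableSet {y : ι → M | ¬ (y ∈ F ↔ y ∈ G)} := by
      have : {y : ι → M | ¬ (y ∈ F ↔ y ∈ G)} = (F \ G) ∪ (G \ F) := by
        ext y; simp only [mem_ofPred_eq, mem_union, Set.mem_sdiff]; tauto
      rw [this]; exact (hF.diff hG).union (hG.diff hF)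
    have h1 : (μ.prod μ) {p | ¬ (p.1 ∈ F ↔ p.1 ∈ G)} = μ {y | ¬ (y ∈ F ↔ y ∈ G)} := by
      have := (measurePreserving_fst (μ := μ) (ν := μ)).measure_preimage hm.nullMeasurableSet
      exact this
    have h2 : (μ.prod μ) {p | ¬ ((swapOn K p).1 ∈ F ↔ (swapOn K p).1 ∈ G)} =
        (μ.prod μ) {p | ¬ (p.1 ∈ F ↔ p.1 ∈ G)} := by
      conv_rhs => rw [← map_swapOn ν K]
      exact (Measure.map_apply (measurable_swapOn K) (measurable_fst hm)).symm
    rw [h2, h1]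
    exact hFG.le
  calc (μ.prod μ) {p | ¬ (p.1 ∈ F ↔ (swapOn H p).1 ∈ F)}
      ≤ (μ.prod μ) ({p | ¬ (p.1 ∈ F ↔ (swapOn (s' : Set ι) p).1 ∈ F)} ∪
        ({p | ¬ ((swapOn (s' : Set ι) p).1 ∈ F ↔ (swapOn (s' : Set ι) p).1 ∈ G)} ∪
          {p | ¬ ((swapOn H p).1 ∈ F ↔ (swapOn H p).1 ∈ G)})) := by
        refine measure_mono fun p => ?_
        have := hagree p
        simp only [mem_ofPred_eq, mem_union]
        tauto
    _ ≤ ∑ z ∈ s', influence ν F z + ((ε : ENNReal) / 2 + (ε : ENNReal) / 2) :=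
        (measure_union_le _ _).trans (add_le_add (measure_swapOn_finset_le ν hF s')
          ((measure_union_le _ _).trans (add_le_add (hlaw _) (hlaw _))))
    _ ≤ ∑' z : H, influence ν F z + ε := by
        rw [ENNReal.add_halves]
        gcongr
        have : ∑ z ∈ s', influence ν F z = ∑ z ∈ s'.subtype (· ∈ H), influence ν F z :=
          (Finset.sum_subtype_of_mem (fun z => influence ν F z) (by simp [s'])).symm
        rw [this]
        exact ENNReal.sum_le_tsum _

/-- Approximate independence of an event that is insensitive to the coordinates off `H` and an
event that is insensitive to the coordinates in `H`. -/
lemma measure_inter_le_of_influence [DecidableEq ι] {F G : Set (ι → M)} (hF : MeasurableSet F)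
    (hG : MeasurableSet G) (r : ι → ENNReal) (H : Set ι)
    (hFr : ∀ z ∉ H, influence ν F z ≤ r z) (hGr : ∀ z ∈ H, influence ν G z ≤ r z) :
    (Measure.infinitePi fun _ : ι => ν) (F ∩ G) ≤
      (Measure.infinitePi fun _ : ι => ν) F * (Measure.infinitePi fun _ : ι => ν) G +
        ∑' z, r z := by
  classical
  set μ := Measure.infinitePi fun _ : ι => ν
  have hFH := measure_swapOn_le ν hF Hᶜ
  have hGH := measure_swapOn_le ν hG H
  -- Up to influences, `F` is read on the first component of the field swapped off `H` and `G` on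
  -- the second; these two components are independent.
  have h2 : ∀ p : (ι → M) × (ι → M), (swapOn Hᶜ p).2 = (swapOn H p).1 := by
    intro p; ext i; by_cases hi : i ∈ H <;> simp [swapOn, hi]
  have hprod : (μ.prod μ) (swapOn Hᶜ ⁻¹' (F ×ˢ G)) = μ F * μ G := by
    rw [← Measure.prod_prod, ← Measure.map_apply (measurable_swapOn _) (hF.prod hG), map_swapOn]
  have hfst : (μ.prod μ) (Prod.fst ⁻¹' (F ∩ G)) = μ (F ∩ G) :=
    (measurePreserving_fst (μ := μ) (ν := μ)).measure_preimage (hF.inter hG).nullMeasurableSet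
  rw [← hfst, ← hprod]
  calc (μ.prod μ) (Prod.fst ⁻¹' (F ∩ G))
      ≤ (μ.prod μ) (swapOn Hᶜ ⁻¹' (F ×ˢ G) ∪ ({p | ¬ (p.1 ∈ F ↔ (swapOn Hᶜ p).1 ∈ F)} ∪
          {p | ¬ (p.1 ∈ G ↔ (swapOn H p).1 ∈ G)})) := by
        refine measure_mono fun p => ?_
        simp only [mem_ofPred_eq, mem_union, mem_preimage, mem_inter_iff, mem_prod, h2]
        tauto
    _ ≤ (μ.prod μ) (swapOn Hᶜ ⁻¹' (F ×ˢ G)) +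
          (∑' z : (Hᶜ : Set ι), influence ν F z + ∑' z : H, influence ν G z) :=
        (measure_union_le _ _).trans
          (add_le_add le_rfl ((measure_union_le _ _).trans (add_le_add hFH hGH)))
    _ ≤ (μ.prod μ) (swapOn Hᶜ ⁻¹' (F ×ˢ G)) + ∑' z, r z := by
        gcongr
        rw [← ENNReal.summable.tsum_add_tsum_compl (s := H) ENNReal.summable (f := r), add_comm]
        exact add_le_add (ENNReal.tsum_le_tsum fun z => hGr z z.2)
          (ENNReal.tsum_le_tsum fun z => hFr z z.2)

end Resampling

/-! ### Approximate independence from action radii -/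

/-- Events of the random set that only depend on what happens in `U`. -/
def DependsOnlyOn {d : ℕ} (A : Set (Set (E d))) (U : Set (E d)) : Prop :=
  ∀ S S' : Set (E d), S ∩ U = S' ∩ U → (S ∈ A ↔ S' ∈ A)

/-- Resampling `z` changes the random set only within distance `R z` of `z`. If an event living in
`W` changes, the radius must exceed the `r z` for which the ball misses `W`, so the influence of `z`
is at most `tail (r z)`. The set `H` assigns each site to one of the events, the other one being far
from it. -/
lemma HasActionRadii.measure_inter_le {d : ℕ} {Ω : Type u} [MeasurableSpace Ω] {P : Measure Ω}
    [IsProbabilityMeasure P] {𝓘 : InclusionProcess d P} {tail : ℝ → ℝ}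
    (h : HasActionRadii.{u, v} 𝓘 tail) {A B : Set (Set (E d))} (hA : MeasurableSet A)
    (hB : MeasurableSet B) {U V : Set (E d)} (hU : DependsOnlyOn A U) (hV : DependsOnlyOn B V)
    (r : Lattice d → ℝ) (hr : ∀ z, 0 < r z) (H : Set (Lattice d))
    (hUr : ∀ z ∉ H, Disjoint U (Metric.ball (latticePoint z) (r z)))
    (hVr : ∀ z ∈ H, Disjoint V (Metric.ball (latticePoint z) (r z))) :
    P {ω | 𝓘.total ω ∈ A ∩ B} ≤
      P {ω | 𝓘.total ω ∈ A} * P {ω | 𝓘.total ω ∈ B} + ∑' z, ENNReal.ofReal (tail (r z)) := by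
  classical
  obtain ⟨M, _, ν, _, X, Φ, R, hX, hXν, hind, hΦ, htot, hR⟩ := h
  set μ := Measure.infinitePi fun _ : Lattice d => ν
  have hXm : Measurable fun ω y => X y ω := measurable_pi_lambda _ hX
  have hlaw : P.map (fun ω y => X y ω) = μ := by
    rw [hind.map_fun_eq_infinitePi_map hX]
    simp only [hXν]
    rfl
  have hP : ∀ C : Set (Set (E d)), MeasurableSet C → P {ω | 𝓘.total ω ∈ C} = μ (Φ ⁻¹' C) := by
    intro C hC
    rw [← hlaw, Measure.map_apply hXm (hΦ hC)]
    refine measure_congr ?_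
    filter_upwards [htot] with ω hω
    change (𝓘.total ω ∈ C) = (Φ (fun y => X y ω) ∈ C)
    rw [hω]
  have hinf : ∀ (C : Set (Set (E d))) (W : Set (E d)) (z : Lattice d), MeasurableSet C →
      DependsOnlyOn C W → Disjoint W (Metric.ball (latticePoint z) (r z)) →
      influence ν (Φ ⁻¹' C) z ≤ ENNReal.ofReal (tail (r z)) := by
    intro C W z hC hCW hW
    obtain ⟨-, -, hloc, htail⟩ := hR z
    have hm := measurableSet_not_iff measurable_fst (measurable_resample (M := M) z) (hΦ hC)
    have hmap : (P.prod μ).map (Prod.map (fun ω y => X y ω) id) = μ.prod μ := by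
      rw [← Measure.map_prod_map _ _ hXm measurable_id, hlaw, Measure.map_id]
    rw [influence, ← hmap, Measure.map_apply (hXm.prodMap measurable_id) hm]
    refine le_trans ?_ (ENNReal.ofReal_le_ofReal (htail (r z) (hr z)))
    rw [measureReal_def, ENNReal.ofReal_toReal (measure_ne_top _ _)]
    refine measure_mono_ae ?_
    filter_upwards [hloc] with p hp hne
    by_contra hRr
    have hRr' : R z (fun y => X y p.1, p.2) ≤ r z := not_lt.1 hRr
    refine hne (hCW _ _ ?_).symm
    have hWb : Disjoint W (Metric.ball (latticePoint z) (R z (fun y => X y p.1, p.2))) :=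
      hW.mono_right (Metric.ball_subset_ball hRr')
    ext x
    simp only [mem_inter_iff]
    constructor
    · rintro ⟨h1, h2⟩
      exact ⟨(hp.subset ⟨h1, fun hb => hWb.le_bot ⟨h2, hb⟩⟩).1, h2⟩
    · rintro ⟨h1, h2⟩
      exact ⟨(hp.superset ⟨h1, fun hb => hWb.le_bot ⟨h2, hb⟩⟩).1, h2⟩
  rw [hP _ (hA.inter hB), hP _ hA, hP _ hB, preimage_inter]
  exact measure_inter_le_of_influence ν (hΦ hA) (hΦ hB) _ H
    (fun z hz => hinf A U z hA hU (hUr z hz)) (fun z hz => hinf B V z hB hV (hVr z hz))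

/-! ### The maximum norm -/

variable {d : ℕ}

/-- The distance of the maximum norm. -/
def supDist (p q : E d) : ℝ := dist p.ofLp q.ofLp

lemma supDist_nonneg (p q : E d) : 0 ≤ supDist p q := dist_nonneg

lemma supDist_comm (p q : E d) : supDist p q = supDist q p := dist_comm _ _

lemma supDist_triangle (p q r : E d) : supDist p r ≤ supDist p q + supDist q r :=
  dist_triangle _ _ _

lemma abs_sub_le_supDist (p q : E d) (i : Fin d) : |p i - q i| ≤ supDist p q := by
  simpa [Real.dist_eq, supDist] using dist_le_pi_dist p.ofLp q.ofLp i

lemma supDist_le_iff {p q : E d} {r : ℝ} (hr : 0 ≤ r) :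
    supDist p q ≤ r ↔ ∀ i, |p i - q i| ≤ r := by
  simp [supDist, dist_pi_le_iff hr, Real.dist_eq]

lemma supDist_le_dist (p q : E d) : supDist p q ≤ dist p q := by
  refine (supDist_le_iff dist_nonneg).2 fun i => ?_
  rw [dist_eq_norm, ← Real.norm_eq_abs]
  exact PiLp.norm_apply_le (p - q) i

lemma dist_le_mul_supDist (p q : E d) : dist p q ≤ d * supDist p q := by
  rw [EuclideanSpace.dist_eq]
  refine Real.sqrt_le_iff.2 ⟨mul_nonneg d.cast_nonneg (supDist_nonneg _ _), ?_⟩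
  calc ∑ i, dist (p i) (q i) ^ 2 ≤ ∑ _i : Fin d, supDist p q ^ 2 := by
        refine Finset.sum_le_sum fun i _ => ?_
        rw [Real.dist_eq]
        exact pow_le_pow_left₀ (abs_nonneg _) (abs_sub_le_supDist p q i) 2
    _ = d * supDist p q ^ 2 := by simp
    _ ≤ (d * supDist p q) ^ 2 := by
        rw [mul_pow]
        refine mul_le_mul_of_nonneg_right ?_ (sq_nonneg _)
        rcases Nat.eq_zero_or_pos d with rfl | h
        · simp
        · have : (1 : ℝ) ≤ d := by exact_mod_cast h
          nlinarith

lemma supDist_add_left (z p q : E d) : supDist (z + p) (z + q) = supDist p q := by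
  simp [supDist]

lemma continuous_supDist (q : E d) : Continuous fun p => supDist p q := by
  unfold supDist
  fun_prop

lemma supDist_le_supDist_add_dist (x p q : E d) : supDist q x ≤ supDist p x + dist p q := by
  have h1 := supDist_triangle q p x
  have h2 := supDist_le_dist q p
  rw [dist_comm] at h2
  linarith

/-- The open ball of the maximum norm. -/
def supBall (x : E d) (r : ℝ) : Set (E d) := {p | supDist p x < r}

lemma isOpen_supBall (x : E d) (r : ℝ) : IsOpen (supBall x r) :=
  isOpen_lt (continuous_supDist x) continuous_const

lemma supDist_smul_latticePoint_zero {w : ℝ} (hw : 0 ≤ w) (z : Lattice d) :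
    supDist (w • latticePoint z) 0 = w * ‖z‖ := by
  have : ‖(fun i => (z i : ℝ))‖ = ‖z‖ := by
    simp only [Pi.norm_def]
    congr 2
  simp [supDist, latticePoint, dist_zero_right, norm_smul, abs_of_nonneg hw, this]

/-! ### Chains of small jumps -/

/-- `Link t S a b`: one can go from `a` to `b` by jumps of size less than `t` between points
of `S`. -/
def Link (t : ℝ) (S : Set (E d)) : E d → E d → Prop :=
  Relation.ReflTransGen fun x y => x ∈ S ∧ y ∈ S ∧ dist x y < t

namespace Link

variable {t : ℝ} {S S' : Set (E d)} {a b c : E d}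

lemma symm (h : Link t S a b) : Link t S b a := by
  induction h with
  | refl => exact Relation.ReflTransGen.refl
  | tail _ hbc ih =>
    exact Relation.ReflTransGen.head ⟨hbc.2.1, hbc.1, by rw [dist_comm]; exact hbc.2.2⟩ ih

lemma trans (h : Link t S a b) (h' : Link t S b c) : Link t S a c :=
  Relation.ReflTransGen.trans h h'

lemma mono (hS : S ⊆ S') (h : Link t S a b) : Link t S' a b :=
  Relation.ReflTransGen.mono (fun _ _ ⟨hx, hy, hxy⟩ => ⟨hS hx, hS hy, hxy⟩) _ _ h

lemma single (ha : a ∈ S) (hb : b ∈ S) (h : dist a b < t) : Link t S a b :=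
  Relation.ReflTransGen.single ⟨ha, hb, h⟩

lemma image_add (z : E d) (h : Link t S a b) :
    Link t ((fun x => z + x) '' S) (z + a) (z + b) := by
  refine Relation.ReflTransGen.lift (fun x => z + x) ?_ _ _ h
  rintro x y ⟨hx, hy, hxy⟩
  exact ⟨mem_image_of_mem _ hx, mem_image_of_mem _ hy, by simpa using hxy⟩

lemma exists_finite (h : Link t S a b) (ha : a ∈ S) :
    ∃ F : Set (E d), F.Finite ∧ F ⊆ S ∧ a ∈ F ∧ b ∈ F ∧ Link t F a b := by
  induction h with
  | refl => exact ⟨{a}, finite_singleton _, by simpa, rfl, rfl, Relation.ReflTransGen.refl⟩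
  | @tail b c _ hbc ih =>
    obtain ⟨F, hF, hFS, haF, hbF, hl⟩ := ih
    refine ⟨insert c F, hF.insert c, insert_subset hbc.2.1 hFS, mem_insert_of_mem _ haF,
      mem_insert _ _, ?_⟩
    exact (hl.mono (subset_insert _ _)).trans
      (single (mem_insert_of_mem _ hbF) (mem_insert _ _) hbc.2.2)

/-- The first passage of a chain above the level `s`. -/
lemma exists_exit {f : E d → ℝ} (hf : ∀ p q, f q ≤ f p + dist p q) {s : ℝ} (h : Link t S a b)
    (ha : f a ≤ s) (hb : s < f b) :
    ∃ p ∈ S, s < f p ∧ f p < s + t ∧ Link t (S ∩ {q | f q < s + t}) a p := by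
  -- Induction on the chain: either it has not left the sublevel set yet, or an exit has been
  -- recorded. Since `f` grows by less than `t` per jump, the exit point lies below `s + t`.
  suffices H : (f b ≤ s ∧ Link t (S ∩ {q | f q < s + t}) a b) ∨
      ∃ p ∈ S, s < f p ∧ f p < s + t ∧ Link t (S ∩ {q | f q < s + t}) a p by
    rcases H with H | H
    · exact absurd H.1 (not_le.2 hb)
    · exact H
  clear hb
  induction h with
  | refl => exact Or.inl ⟨ha, Relation.ReflTransGen.refl⟩
  | @tail b c _ hbc ih =>
    rcases ih with ⟨hb, hl⟩ | ih
    · have hfc := hf b c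
      have hc : f c < s + t := by linarith [hbc.2.2]
      have ht : 0 < t := lt_of_le_of_lt dist_nonneg hbc.2.2
      have hl' : Link t (S ∩ {q | f q < s + t}) a c := hl.trans
        (single ⟨hbc.1, lt_of_le_of_lt hb (by linarith)⟩ ⟨hbc.2.1, hc⟩ hbc.2.2)
      rcases le_or_gt (f c) s with hcs | hcs
      · exact Or.inl ⟨hcs, hl'⟩
      · exact Or.inr ⟨c, hbc.2.1, hcs, hc, hl'⟩
    · exact Or.inr ih

lemma _root_.Dense.exists_mem_of_eventually {X : Type*} [TopologicalSpace X] {D : Set X}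
    (hD : Dense D) {x : X} {p : X → Prop} (h : ∀ᶠ y in 𝓝 x, p y) : ∃ y ∈ D, p y := by
  obtain ⟨y, hy, hp⟩ := ((mem_closure_iff_frequently.1 (hD x)).and_eventually h).exists
  exact ⟨y, hy, hp⟩

/-- Jumps satisfy strict inequalities, so vertices of a chain in an open set can be moved into `D`
one after the other. Stating this for all endpoints near `b` lets the induction choose the moved
vertex when the next one is reached. -/
lemma eventually_dense (hS : IsOpen S) {D : Set (E d)} (hD : Dense D) (h : Link t S a b) {a' : E d} (ha : a' ∈ S ∩ D) (haa : dist a' a < t) :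
    ∀ᶠ b' in 𝓝 b, b' ∈ S ∩ D → Link t (S ∩ D) a' b' := by
  induction h with
  | refl =>
    have : ∀ᶠ b' in 𝓝 a, dist a' b' < t :=
      (isOpen_lt (continuous_const.dist continuous_id) continuous_const).eventually_mem haa
    filter_upwards [this] with b' hb' hb
    exact single ha hb hb'
  | @tail b c _ hbc ih =>
    have h1 : ∀ᶠ b' in 𝓝 b, dist b' c < t :=
      (isOpen_lt (continuous_id.dist continuous_const) continuous_const).eventually_mem hbc.2.2
    obtain ⟨b', hb'D, hl, hb'c, hb'S⟩ :=
      hD.exists_mem_of_eventually (ih.and (h1.and (hS.eventually_mem hbc.1)))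
    have h2 : ∀ᶠ c' in 𝓝 c, dist b' c' < t :=
      (isOpen_lt (continuous_const.dist continuous_id) continuous_const).eventually_mem hb'c
    filter_upwards [h2] with c' hc' hc
    exact (hl ⟨hb'S, hb'D⟩).trans (single ⟨hb'S, hb'D⟩ hc hc')

lemma mem_connectedComponentIn (h : Link t S a b) (ha : a ∈ S) (ht : 0 < t) :
    b ∈ connectedComponentIn (Metric.thickening t S) a := by
  induction h with
  | refl => exact _root_.mem_connectedComponentIn (Metric.self_subset_thickening ht S ha)
  | @tail b c _ hbc ih =>
    rw [connectedComponentIn_eq ih]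
    refine (convex_ball b t).isPreconnected.subset_connectedComponentIn (Metric.mem_ball_self ht)
      (Metric.ball_subset_thickening hbc.1 t) ?_
    rw [Metric.mem_ball, dist_comm]
    exact hbc.2.2

/-- Points of `S` in a connected subset of the fattened set are linked. -/
lemma of_isPreconnected {C : Set (E d)} (hC : IsPreconnected C)
    (hCS : C ⊆ Metric.thickening (t / 2) S) (ha : a ∈ C ∩ S) (hb : b ∈ C ∩ S) :
    Link t S a b := by
  have ht : 0 < t / 2 := by
    obtain ⟨x, -, hx⟩ := Metric.mem_thickening_iff.1 (hCS ha.1)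
    exact lt_of_le_of_lt dist_nonneg hx
  by_contra hab
  -- Balls of radius `t / 2` around linked and unlinked points cover `C`. A ball of one kind meeting
  -- one of the other would give a jump smaller than `t` between them.
  let U : Set (E d) := ⋃ x ∈ {x | x ∈ S ∧ Link t S a x}, Metric.ball x (t / 2)
  let V : Set (E d) := ⋃ x ∈ {x | x ∈ S ∧ ¬ Link t S a x}, Metric.ball x (t / 2)
  have hU : IsOpen U := isOpen_biUnion fun _ _ => Metric.isOpen_ball
  have hV : IsOpen V := isOpen_biUnion fun _ _ => Metric.isOpen_ball
  have hcov : C ⊆ U ∪ V := by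
    intro y hy
    obtain ⟨x, hx, hyx⟩ := Metric.mem_thickening_iff.1 (hCS hy)
    by_cases h : Link t S a x
    · exact Or.inl (mem_biUnion (show x ∈ {x | x ∈ S ∧ Link t S a x} from ⟨hx, h⟩) hyx)
    · exact Or.inr (mem_biUnion (show x ∈ {x | x ∈ S ∧ ¬ Link t S a x} from ⟨hx, h⟩) hyx)
  obtain ⟨y, -, hyU, hyV⟩ := hC U V hU hV hcov
    ⟨a, ha.1, mem_biUnion (show a ∈ {x | x ∈ S ∧ Link t S a x} from
      ⟨ha.2, Relation.ReflTransGen.refl⟩) (Metric.mem_ball_self ht)⟩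
    ⟨b, hb.1, mem_biUnion (show b ∈ {x | x ∈ S ∧ ¬ Link t S a x} from ⟨hb.2, hab⟩)
      (Metric.mem_ball_self ht)⟩
  simp only [U, V, mem_iUnion] at hyU hyV
  obtain ⟨x, ⟨hx, hax⟩, hyx⟩ := hyU
  obtain ⟨x', ⟨hx', hax'⟩, hyx'⟩ := hyV
  refine hax' (hax.trans (single hx hx' ?_))
  have h1 : dist y x < t / 2 := hyx
  have h2 : dist y x' < t / 2 := hyx'
  have h3 := dist_triangle_left x x' y
  linarith

end Link

/-! ### Testable events: crossing, vacancy, long chains -/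

/-- The σ-algebra on `Set α` only sees membership of individual points. An increasing event with
finite witnesses, read on a countable `D`, is a countable union over finite `F ⊆ D` of the events `F
⊆ S`. -/
lemma measurableSet_of_finite_witness {α : Type*} {D : Set α} (hD : D.Countable)
    {A : Set (Set α)} (hmono : ∀ S S', S ⊆ S' → S ∈ A → S' ∈ A)
    (hfin : ∀ S ∈ A, ∃ F : Set α, F.Finite ∧ F ⊆ S ∧ F ∈ A) :
    MeasurableSet {S : Set α | S ∩ D ∈ A} := by
  have : {S : Set α | S ∩ D ∈ A} =
      ⋃ F ∈ {F : Set α | F.Finite ∧ F ⊆ D} ∩ A, ⋂ p ∈ F, {S : Set α | p ∈ S} := by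
    ext S
    simp only [mem_ofPred_eq, mem_iUnion, mem_iInter, mem_inter_iff]
    constructor
    · intro h
      obtain ⟨F, hF, hFS, hFA⟩ := hfin _ h
      exact ⟨F, ⟨⟨hF, hFS.trans inter_subset_right⟩, hFA⟩, fun p hp => (hFS hp).1⟩
    · rintro ⟨F, ⟨⟨-, hFD⟩, hFA⟩, hFS⟩
      exact hmono _ _ (fun p hp => ⟨hFS p hp, hFD hp⟩) hFA
  rw [this]
  refine MeasurableSet.biUnion ((countable_ofPred_finite_subset hD).mono inter_subset_left) ?_
  rintro F ⟨⟨hF, -⟩, -⟩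
  exact MeasurableSet.biInter hF.countable fun p _ => measurableSet_setOfPred.2 (measurable_set_mem p)

/-- The random set has a chain from the box of radius `w` at `x` to the complement of the box of
radius `2 w`. -/
def crossing (t : ℝ) (x : E d) (w : ℝ) : Set (Set (E d)) :=
  {S | ∃ a ∈ S, ∃ b ∈ S, supDist a x < w ∧ 2 * w < supDist b x ∧ supDist b x < 3 * w ∧
    Link t (S ∩ supBall x (3 * w)) a b}

/-- The random set does not meet the box of radius `3 w` at `x`. -/
def vacant (x : E d) (w : ℝ) : Set (Set (E d)) := {S | ∀ p ∈ S, 3 * w ≤ supDist p x}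

/-- There is a chain of length larger than `r` that starts close to the origin. -/
def farLink (h r : ℝ) : Set (Set (E d)) :=
  {S | ∃ a ∈ S, ∃ b ∈ S, ‖a‖ < h ∧ r < dist a b ∧ Link h S a b}

/-- An event is well behaved if it can be tested on a countable dense set. -/
structure Testable (A : Set (Set (E d))) : Prop where
  measurable : ∀ D : Set (E d), D.Countable → MeasurableSet {S | S ∩ D ∈ A}
  dense : ∀ D : Set (E d), Dense D → ∀ S, IsOpen S → (S ∩ D ∈ A ↔ S ∈ A)

/-- The conditions defining `crossing` are open, so in an open set endpoints and chain can be moved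
into the dense set; only finitely many points are used. -/
lemma testable_crossing {t : ℝ} (ht : 0 < t) (x : E d) (w : ℝ) : Testable (crossing t x w) := by
  have hmono : ∀ S S' : Set (E d), S ⊆ S' → S ∈ crossing t x w → S' ∈ crossing t x w := by
    rintro S S' h ⟨a, ha, b, hb, h1, h2, h3, hl⟩
    exact ⟨a, h ha, b, h hb, h1, h2, h3, hl.mono (inter_subset_inter_left _ h)⟩
  have hw : ∀ a : E d, supDist a x < w → supDist a x < 3 * w := fun a ha => by
    linarith [supDist_nonneg a x]
  refine ⟨fun D hD => measurableSet_of_finite_witness hD hmono ?_, fun D hD S hS =>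
    ⟨hmono _ _ inter_subset_left, ?_⟩⟩
  · rintro S ⟨a, ha, b, hb, h1, h2, h3, hl⟩
    obtain ⟨F, hF, hFS, haF, hbF, hl'⟩ := hl.exists_finite ⟨ha, hw a h1⟩
    exact ⟨F, hF, hFS.trans inter_subset_left, a, haF, b, hbF, h1, h2, h3,
      hl'.mono fun p hp => ⟨hp, (hFS hp).2⟩⟩
  · rintro ⟨a, ha, b, hb, h1, h2, h3, hl⟩
    have hSB : IsOpen (S ∩ supBall x (3 * w)) := hS.inter (isOpen_supBall x _)
    obtain ⟨a', ha'D, ha'S, haa, h1'⟩ := hD.exists_mem_of_eventually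
      ((hSB.eventually_mem ⟨ha, hw a h1⟩).and ((Metric.isOpen_ball.eventually_mem (Metric.mem_ball_self ht)).and
        ((isOpen_supBall x w).eventually_mem h1)))
    obtain ⟨b', hb'D, hb'S, h2', hl'⟩ := hD.exists_mem_of_eventually
      ((hSB.eventually_mem ⟨hb, h3⟩).and (((isOpen_lt continuous_const
        (continuous_supDist x)).eventually_mem h2).and
          (hl.eventually_dense hSB hD ⟨ha'S, ha'D⟩ haa)))
    refine ⟨a', ⟨ha'S.1, ha'D⟩, b', ⟨hb'S.1, hb'D⟩, h1', h2', hb'S.2, ?_⟩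
    exact (hl' ⟨hb'S, hb'D⟩).mono fun p hp => ⟨⟨hp.1.1, hp.2⟩, hp.1.2⟩

lemma testable_farLink {h : ℝ} (hh : 0 < h) (r : ℝ) :
    Testable (farLink h r : Set (Set (E d))) := by
  have hmono : ∀ S S' : Set (E d), S ⊆ S' → S ∈ farLink h r → S' ∈ farLink h r := by
    rintro S S' h ⟨a, ha, b, hb, h1, h2, hl⟩
    exact ⟨a, h ha, b, h hb, h1, h2, hl.mono h⟩
  refine ⟨fun D hD => measurableSet_of_finite_witness hD hmono ?_, fun D hD S hS =>
    ⟨hmono _ _ inter_subset_left, ?_⟩⟩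
  · rintro S ⟨a, ha, b, hb, h1, h2, hl⟩
    obtain ⟨F, hF, hFS, haF, hbF, hl'⟩ := hl.exists_finite ha
    exact ⟨F, hF, hFS, a, haF, b, hbF, h1, h2, hl'⟩
  · rintro ⟨a, ha, b, hb, h1, h2, hl⟩
    have e1 : ∀ᶠ y in 𝓝 a, ‖y‖ < h :=
      (isOpen_lt continuous_norm continuous_const).eventually_mem h1
    have e2 : ∀ᶠ y in 𝓝 a, r < dist y b :=
      (isOpen_lt continuous_const (continuous_id.dist continuous_const)).eventually_mem h2
    obtain ⟨a', ha'D, ha'S, haa, h1', h2'⟩ := hD.exists_mem_of_eventually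
      ((hS.eventually_mem ha).and ((Metric.isOpen_ball.eventually_mem
        (Metric.mem_ball_self hh)).and (e1.and e2)))
    have e3 : ∀ᶠ y in 𝓝 b, r < dist a' y :=
      (isOpen_lt continuous_const (continuous_const.dist continuous_id)).eventually_mem h2'
    obtain ⟨b', hb'D, hb'S, h3', hl'⟩ := hD.exists_mem_of_eventually
      ((hS.eventually_mem hb).and (e3.and (hl.eventually_dense hS hD ⟨ha'S, ha'D⟩ haa)))
    exact ⟨a', ⟨ha'S, ha'D⟩, b', ⟨hb'S, hb'D⟩, h1', h3', hl' ⟨hb'S, hb'D⟩⟩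

lemma testable_vacant (x : E d) (w : ℝ) : Testable (vacant x w) := by
  refine ⟨fun D hD => ?_, fun D hD S hS => ⟨fun h p hp => ?_, fun h p hp => h p hp.1⟩⟩
  · have : {S : Set (E d) | S ∩ D ∈ vacant x w} =
        ⋂ p ∈ D ∩ supBall x (3 * w), {S : Set (E d) | p ∈ S}ᶜ := by
      ext S
      simp only [vacant, supBall, mem_ofPred_eq, mem_iInter, mem_inter_iff, mem_compl_iff]
      refine ⟨fun h p hp hpS => absurd (h p ⟨hpS, hp.1⟩) (not_le.2 hp.2), fun h p hp => ?_⟩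
      by_contra hlt
      exact h p ⟨hp.2, not_le.1 hlt⟩ hp.1
    rw [this]
    exact MeasurableSet.biInter (hD.mono inter_subset_left) fun p _ =>
      (measurableSet_setOfPred.2 (measurable_set_mem p)).compl
  · by_contra hlt
    obtain ⟨p', hp'D, hp'S, hp'⟩ := hD.exists_mem_of_eventually
      ((hS.eventually_mem hp).and ((isOpen_supBall x (3 * w)).eventually_mem (not_le.1 hlt)))
    exact absurd (h p' ⟨hp'S, hp'D⟩) (not_le.2 hp')

lemma dependsOnlyOn_crossing (t : ℝ) (x : E d) (w : ℝ) :
    DependsOnlyOn (crossing t x w) (supBall x (3 * w)) := by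
  have : ∀ S S' : Set (E d), S ∩ supBall x (3 * w) = S' ∩ supBall x (3 * w) →
      S ∈ crossing t x w → S' ∈ crossing t x w := by
    rintro S S' h ⟨a, ha, b, hb, h1, h2, h3, hl⟩
    have ha' : a ∈ S ∩ supBall x (3 * w) :=
      ⟨ha, show supDist a x < 3 * w by linarith [supDist_nonneg a x]⟩
    have hb' : b ∈ S ∩ supBall x (3 * w) := ⟨hb, h3⟩
    rw [h] at ha' hb' hl
    exact ⟨a, ha'.1, b, hb'.1, h1, h2, h3, hl⟩
  exact fun S S' h => ⟨this S S' h, this S' S h.symm⟩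

lemma dependsOnlyOn_vacant (x : E d) (w : ℝ) :
    DependsOnlyOn (vacant x w) (supBall x (3 * w)) := by
  have : ∀ S S' : Set (E d), S ∩ supBall x (3 * w) = S' ∩ supBall x (3 * w) →
      S ∈ vacant x w → S' ∈ vacant x w := by
    intro S S' h hS p hp
    by_contra hlt
    have : p ∈ S' ∩ supBall x (3 * w) := ⟨hp, not_le.1 hlt⟩
    rw [← h] at this
    exact hlt (hS p this.1)
  exact fun S S' h => ⟨this S S' h, this S' S h.symm⟩

lemma crossing_image_add {t : ℝ} {z x : E d} {w : ℝ} {S : Set (E d)} (h : S ∈ crossing t x w) :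
    (fun p => z + p) '' S ∈ crossing t (z + x) w := by
  obtain ⟨a, ha, b, hb, h1, h2, h3, hl⟩ := h
  refine ⟨z + a, mem_image_of_mem _ ha, z + b, mem_image_of_mem _ hb, ?_, ?_, ?_,
    (hl.image_add z).mono ?_⟩
  · rwa [supDist_add_left]
  · rwa [supDist_add_left]
  · rwa [supDist_add_left]
  · rintro _ ⟨p, hp, rfl⟩
    refine ⟨mem_image_of_mem _ hp.1, ?_⟩
    change supDist (z + p) (z + x) < _
    rw [supDist_add_left]
    exact hp.2

lemma vacant_image_add {z x : E d} {w : ℝ} {S : Set (E d)} (h : S ∈ vacant x w) :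
    (fun p => z + p) '' S ∈ vacant (z + x) w := by
  rintro _ ⟨p, hp, rfl⟩
  change _ ≤ supDist (z + p) (z + x)
  rw [supDist_add_left]
  exact h p hp

lemma Testable.biUnion {ι : Type*} {s : Finset ι} {A : ι → Set (Set (E d))}
    (h : ∀ i ∈ s, Testable (A i)) : Testable (⋃ i ∈ s, A i) := by
  refine ⟨fun D hD => ?_, fun D hD S hS => ?_⟩
  · have : {S : Set (E d) | S ∩ D ∈ ⋃ i ∈ s, A i} = ⋃ i ∈ s, {S | S ∩ D ∈ A i} := by
      ext S; simp
    rw [this]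
    exact Finset.measurableSet_biUnion _ fun i hi => (h i hi).measurable D hD
  · simp only [mem_iUnion]
    exact exists_congr fun i => exists_congr fun hi => (h i hi).dense D hD S hS

lemma Testable.inter {A B : Set (Set (E d))} (hA : Testable A) (hB : Testable B) :
    Testable (A ∩ B) :=
  ⟨fun D hD => (hA.measurable D hD).inter (hB.measurable D hD),
    fun D hD S hS => and_congr (hA.dense D hD S hS) (hB.dense D hD S hS)⟩

lemma testable_univ : Testable (univ : Set (Set (E d))) :=
  ⟨fun _ _ => by simp, fun _ _ _ _ => by simp⟩

lemma DependsOnlyOn.mono {A : Set (Set (E d))} {U V : Set (E d)} (h : DependsOnlyOn A U)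
    (hUV : U ⊆ V) : DependsOnlyOn A V := by
  intro S S' hS
  refine h S S' ?_
  rw [← inter_eq_self_of_subset_right hUV, ← inter_assoc, ← inter_assoc, hS]

lemma DependsOnlyOn.biUnion {ι : Type*} {s : Finset ι} {A : ι → Set (Set (E d))} {U : Set (E d)}
    (h : ∀ i ∈ s, DependsOnlyOn (A i) U) : DependsOnlyOn (⋃ i ∈ s, A i) U := by
  intro S S' hS
  simp only [mem_iUnion]
  exact exists_congr fun i => exists_congr fun hi => h i hi S S' hS

lemma DependsOnlyOn.inter {A B : Set (Set (E d))} {U : Set (E d)} (hA : DependsOnlyOn A U)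
    (hB : DependsOnlyOn B U) : DependsOnlyOn (A ∩ B) U :=
  fun S S' hS => and_congr (hA S S' hS) (hB S S' hS)

lemma DependsOnlyOn.restrict {A : Set (Set (E d))} {U : Set (E d)} (hA : DependsOnlyOn A U)
    (D : Set (E d)) : DependsOnlyOn {S | S ∩ D ∈ A} U := by
  intro S S' hS
  refine hA _ _ ?_
  rw [inter_right_comm, hS, inter_right_comm]

/-! ### Chains versus clusters -/

namespace InclusionProcess

variable {Ω : Type*} [MeasurableSpace Ω] {P : Measure Ω}

/-- The almost sure properties of a configuration of inclusions. -/
structure Regular (𝓘 : InclusionProcess d P) (ω : Ω) : Prop where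
  isOpen : ∀ n, IsOpen (𝓘.incl n ω)
  isConnected : ∀ n, IsConnected (𝓘.incl n ω)
  closest : ∀ n, Metric.infDist 0 (𝓘.incl 0 ω) ≤ Metric.infDist 0 (𝓘.incl n ω)

lemma ae_regular (𝓘 : InclusionProcess d P) : ∀ᵐ ω ∂P, 𝓘.Regular ω := by
  filter_upwards [𝓘.isOpen_shape, 𝓘.isConnected_shape, 𝓘.zero_closest] with ω h1 h2 h3
  refine ⟨fun n => (Homeomorph.addLeft (𝓘.center n ω)).isOpenMap _ (h1 n), fun n =>
    (h2 n).image _ (by fun_prop), fun n => ?_⟩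
  rcases h3 n with h | h
  exacts [h.le, h.1.le]

lemma incl_subset_total (𝓘 : InclusionProcess d P) (n : ℕ) (ω : Ω) :
    𝓘.incl n ω ⊆ 𝓘.total ω := subset_iUnion (fun n => 𝓘.incl n ω) n

lemma Regular.isOpen_total {𝓘 : InclusionProcess d P} {ω : Ω} (h : 𝓘.Regular ω) :
    IsOpen (𝓘.total ω) := isOpen_iUnion h.isOpen

lemma Regular.total_nonempty {𝓘 : InclusionProcess d P} {ω : Ω} (h : 𝓘.Regular ω) :
    (𝓘.total ω).Nonempty := (h.isConnected 0).nonempty.mono (𝓘.incl_subset_total 0 ω)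

lemma mem_cluster₀ {𝓘 : InclusionProcess d P} {ρ : ℝ} {ω : Ω} {p : E d} :
    p ∈ 𝓘.cluster₀ ρ ω ↔ ∃ K, (𝓘.IsFatComponent ρ ω K ∧ 𝓘.incl 0 ω ⊆ K) ∧
      ∃ n, 𝓘.incl n ω ⊆ K ∧ p ∈ 𝓘.incl n ω := by
  simp only [cluster₀, clusterIn, mem_iUnion, exists_prop]

/-- The chain starts within `h` of the origin, hence in the component of the origin in the
`h`-fattened set. The inclusion `I_0` is at least as close to the origin, so it belongs to the same
component, and so do the inclusions containing the ends of the chain. -/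
lemma Regular.lt_ediam_of_farLink {𝓘 : InclusionProcess d P} {ω : Ω} (hω : 𝓘.Regular ω)
    {h r : ℝ} (hh : 0 < h) (hr : 0 ≤ r) (hf : 𝓘.total ω ∈ farLink h r) :
    ENNReal.ofReal r < Metric.ediam (𝓘.cluster₀ h ω) := by
  obtain ⟨a, ha, b, hb, hah, hab, hl⟩ := hf
  obtain ⟨n, hn⟩ := mem_iUnion.1 ha
  obtain ⟨m, hm⟩ := mem_iUnion.1 hb
  have h0 : Metric.infDist 0 (𝓘.incl 0 ω) < h := by
    refine ((hω.closest n).trans (Metric.infDist_le_dist_of_mem hn)).trans_lt ?_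
    rwa [dist_zero_left]
  obtain ⟨a₀, ha₀, ha₀h⟩ := (Metric.infDist_lt_iff (hω.isConnected 0).nonempty).1 h0
  rw [dist_zero_left] at ha₀h
  set F := Metric.thickening h (𝓘.total ω) with hF
  have hsub : ∀ n, 𝓘.incl n ω ⊆ F := fun n =>
    (𝓘.incl_subset_total n ω).trans (Metric.self_subset_thickening hh _)
  have hball : ∀ x ∈ 𝓘.total ω, ‖x‖ < h → x ∈ connectedComponentIn F 0 := by
    intro x hx hxh
    refine (convex_ball x h).isPreconnected.subset_connectedComponentIn ?_
      (Metric.ball_subset_thickening hx h) (Metric.mem_ball_self hh)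
    rwa [Metric.mem_ball, dist_zero_left]
  have hcomp : ∀ n x, x ∈ 𝓘.incl n ω → x ∈ connectedComponentIn F 0 →
      𝓘.incl n ω ⊆ connectedComponentIn F 0 := by
    intro n x hx hxK
    rw [connectedComponentIn_eq hxK]
    exact (hω.isConnected n).isPreconnected.subset_connectedComponentIn hx (hsub n)
  have haK := hball a ha hah
  have ha₀K := hball a₀ (𝓘.incl_subset_total 0 ω ha₀) ha₀h
  have hbK : b ∈ connectedComponentIn F 0 := by
    rw [connectedComponentIn_eq haK]
    exact hl.mem_connectedComponentIn ha hh
  have hfat : 𝓘.IsFatComponent h ω (connectedComponentIn F 0) ∧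
      𝓘.incl 0 ω ⊆ connectedComponentIn F 0 :=
    ⟨⟨a, hsub n hn, connectedComponentIn_eq haK⟩, hcomp 0 a₀ ha₀ ha₀K⟩
  have haJ : a ∈ 𝓘.cluster₀ h ω := mem_cluster₀.2 ⟨_, hfat, n, hcomp n a hn haK, hn⟩
  have hbJ : b ∈ 𝓘.cluster₀ h ω := mem_cluster₀.2 ⟨_, hfat, m, hcomp m b hm hbK, hm⟩
  refine lt_of_lt_of_le ?_ (Metric.edist_le_ediam_of_mem haJ hbJ)
  rw [edist_dist]
  exact (ENNReal.ofReal_lt_ofReal_iff (hr.trans_lt hab)).2 hab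

/-- Without vacancy, `I_0` comes within Euclidean distance `3 w / 4` of the origin; the `d` in `w /
(4 d)` pays for comparing norms. A cluster of diameter above `6 d w` has a point at distance more
than `3 d w` from `a₀`, hence outside the box of radius `2 w`. As `t ≤ w`, the chain exits that box
inside the box of radius `3 w`. -/
lemma Regular.crossing_or_vacant {𝓘 : InclusionProcess d P} {ω : Ω} (hω : 𝓘.Regular ω)
    (hd : 1 ≤ d) {t r w : ℝ} (hw : 0 < w) (htw : t ≤ w) (hr : 6 * d * w ≤ r)
    (h : ENNReal.ofReal r < Metric.ediam (𝓘.cluster₀ (t / 2) ω)) :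
    𝓘.total ω ∈ crossing t 0 w ∨ 𝓘.total ω ∈ vacant 0 (w / (4 * d)) := by
  have hd' : (1 : ℝ) ≤ d := by exact_mod_cast hd
  refine or_iff_not_imp_right.2 fun hvac => ?_
  simp only [vacant, mem_ofPred_eq, not_forall, not_le] at hvac
  obtain ⟨a, ha, haw⟩ := hvac
  obtain ⟨n, hn⟩ := mem_iUnion.1 ha
  have h0 : Metric.infDist 0 (𝓘.incl 0 ω) < w := by
    refine ((hω.closest n).trans (Metric.infDist_le_dist_of_mem hn)).trans_lt ?_
    rw [dist_comm]
    refine (dist_le_mul_supDist a 0).trans_lt ?_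
    calc d * supDist a 0 < d * (3 * (w / (4 * d))) := by
          exact mul_lt_mul_of_pos_left haw (by linarith)
      _ = 3 / 4 * w := by field_simp
      _ < w := by linarith
  obtain ⟨a₀, ha₀, ha₀w⟩ := (Metric.infDist_lt_iff (hω.isConnected 0).nonempty).1 h0
  rw [dist_comm] at ha₀w
  have ha₀T := 𝓘.incl_subset_total 0 ω ha₀
  obtain ⟨p, hp, q, hq, hpq⟩ : ∃ p ∈ 𝓘.cluster₀ (t / 2) ω, ∃ q ∈ 𝓘.cluster₀ (t / 2) ω,
      r < dist p q := by
    by_contra hcon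
    push Not at hcon
    refine absurd (Metric.ediam_le fun p hp q hq => ?_) (not_le.2 h)
    rw [edist_dist]
    exact ENNReal.ofReal_le_ofReal (hcon p hp q hq)
  have hlink : ∀ x ∈ 𝓘.cluster₀ (t / 2) ω, x ∈ 𝓘.total ω ∧ Link t (𝓘.total ω) a₀ x := by
    intro x hx
    obtain ⟨K, ⟨⟨y, -, rfl⟩, hK0⟩, n, hnK, hxn⟩ := mem_cluster₀.1 hx
    have hxT := 𝓘.incl_subset_total n ω hxn
    exact ⟨hxT, Link.of_isPreconnected isPreconnected_connectedComponentIn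
      (connectedComponentIn_subset _ _) ⟨hK0 ha₀, ha₀T⟩ ⟨hnK hxn, hxT⟩⟩
  obtain ⟨b, hb, hba⟩ : ∃ b ∈ 𝓘.cluster₀ (t / 2) ω, r / 2 < dist b a₀ := by
    by_contra hcon
    push Not at hcon
    have := dist_triangle_right p q a₀
    linarith [hcon p hp, hcon q hq]
  obtain ⟨hbT, hl⟩ := hlink b hb
  have hb2 : 2 * w < supDist b 0 := by
    have h1 := dist_triangle b 0 a₀
    rw [dist_comm 0 a₀] at h1
    have h2 := dist_le_mul_supDist b 0
    by_contra hle
    have h3 : d * supDist b 0 ≤ d * (2 * w) :=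
      mul_le_mul_of_nonneg_left (not_lt.1 hle) (by linarith)
    nlinarith
  have ha₀s : supDist a₀ 0 < w := (supDist_le_dist _ _).trans_lt ha₀w
  obtain ⟨c, hc, hc1, hc2, hcl⟩ := hl.exists_exit (f := fun p => supDist p 0)
    (fun p q => supDist_le_supDist_add_dist 0 p q) (s := 2 * w) (by linarith) hb2
  refine ⟨a₀, ha₀T, c, hc, ha₀s, hc1, by linarith, hcl.mono ?_⟩
  refine inter_subset_inter_right _ fun x hx => ?_
  simp only [mem_ofPred_eq, supBall] at hx ⊢
  linarith

lemma measure_eq_of_testable (𝓘 : InclusionProcess d P) {A : Set (Set (E d))} (hA : Testable A)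
    {D : Set (E d)} (hD : Dense D) :
    P {ω | 𝓘.total ω ∈ A} = P {ω | 𝓘.total ω ∈ {S | S ∩ D ∈ A}} := by
  refine measure_congr ?_
  filter_upwards [𝓘.ae_regular] with ω hω
  exact propext (hA.dense D hD _ hω.isOpen_total).symm

/-- Stationarity applies to measurable events only; the event is replaced by its trace on a
countable dense set, which agrees with it on open sets. -/
lemma measure_image_add (𝓘 : InclusionProcess d P) (hH : ConditionH 𝓘)
    {A : Set (Set (E d))} (hA : Testable A) (z : E d) :
    P {ω | (fun x => z + x) '' 𝓘.total ω ∈ A} = P {ω | 𝓘.total ω ∈ A} := by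
  obtain ⟨D, hDc, hD⟩ := TopologicalSpace.exists_countable_dense (E d)
  rw [𝓘.measure_eq_of_testable hA hD]
  refine Eq.trans ?_ ((hH.inclusions.stationary z).measure_mem_eq (hA.measurable D hDc))
  refine measure_congr ?_
  filter_upwards [𝓘.ae_regular] with ω hω
  exact propext (hA.dense D hD _
    ((Homeomorph.addLeft z).isOpenMap _ hω.isOpen_total)).symm

variable [IsProbabilityMeasure P]

lemma farLink_le_clusterTail (𝓘 : InclusionProcess d P) {h r : ℝ} (hh : 0 < h) (hr : 0 ≤ r) :
    P.real {ω | 𝓘.total ω ∈ farLink h r} ≤ 𝓘.clusterTail h r := by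
  refine ENNReal.toReal_mono (measure_ne_top _ _) (measure_mono_ae ?_)
  filter_upwards [𝓘.ae_regular] with ω hω hf
  exact hω.lt_ediam_of_farLink hh hr hf

lemma clusterTail_le (𝓘 : InclusionProcess d P) (hd : 1 ≤ d) {t r w : ℝ} (hw : 0 < w)
    (htw : t ≤ w) (hr : 6 * d * w ≤ r) :
    𝓘.clusterTail (t / 2) r ≤ P.real {ω | 𝓘.total ω ∈ crossing t 0 w} +
      P.real {ω | 𝓘.total ω ∈ vacant 0 (w / (4 * d))} := by
  refine le_trans ?_ (measureReal_union_le _ _)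
  refine ENNReal.toReal_mono (measure_ne_top _ _) (measure_mono_ae ?_)
  filter_upwards [𝓘.ae_regular] with ω hω hf
  exact hω.crossing_or_vacant hd hw htw hr hf

lemma clusterTail_antitone (𝓘 : InclusionProcess d P) (ρ : ℝ) : Antitone (𝓘.clusterTail ρ) := by
  intro r r' hr
  refine measureReal_mono fun ω hω => ?_
  exact lt_of_le_of_lt (ENNReal.ofReal_le_ofReal hr) hω

end InclusionProcess

/-! ### From the percolation condition to crossing probabilities -/

/-- The lattice points with maximum norm between `k` and `m`. -/
def shell (d k m : ℕ) : Finset (Lattice d) :=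
  Finset.univ.biUnion fun i => Fintype.piFinset fun j =>
    if j = i then (Finset.Icc (-(m : ℤ)) m).filter fun n => (k : ℤ) ≤ |n|
    else Finset.Icc (-(m : ℤ)) m

lemma abs_le_norm (z : Lattice d) (i : Fin d) : ((|z i| : ℤ) : ℝ) ≤ ‖z‖ := by
  rw [Int.cast_abs, ← Int.norm_eq_abs]
  exact norm_le_pi_norm z i

lemma mem_shell (hd : 1 ≤ d) {k m : ℕ} {z : Lattice d} (h1 : (k : ℝ) ≤ ‖z‖) (h2 : ‖z‖ ≤ m) :
    z ∈ shell d k m := by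
  have hle : ∀ i, |z i| ≤ (m : ℤ) := fun i => by
    have := (abs_le_norm z i).trans h2
    exact_mod_cast this
  obtain ⟨i, hi⟩ : ∃ i, (k : ℤ) ≤ |z i| := by
    by_contra hcon
    push Not at hcon
    have hk : (0 : ℝ) < k := by
      have := (abs_nonneg _).trans_lt (hcon ⟨0, hd⟩)
      exact_mod_cast this
    refine absurd h1 (not_le.2 ((pi_norm_lt_iff hk).2 fun i => ?_))
    rw [Int.norm_eq_abs, ← Int.cast_abs]
    exact_mod_cast hcon i
  simp only [shell, Finset.mem_biUnion, Finset.mem_univ, true_and, Fintype.mem_piFinset]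
  refine ⟨i, fun j => ?_⟩
  split_ifs with hj
  · subst hj
    exact Finset.mem_filter.2 ⟨Finset.mem_Icc.2 (abs_le.1 (hle j)), hi⟩
  · exact Finset.mem_Icc.2 (abs_le.1 (hle j))

lemma card_shell_le {k m : ℕ} (hkm : k ≤ m) :
    (shell d k m).card ≤ d * (2 * (m + 1 - k)) * (2 * m + 1) ^ (d - 1) := by
  have hI : (Finset.Icc (-(m : ℤ)) m).card = 2 * m + 1 := by
    rw [Int.card_Icc]; omega
  have hF : ((Finset.Icc (-(m : ℤ)) m).filter fun n => (k : ℤ) ≤ |n|).card ≤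
      2 * (m + 1 - k) := by
    have hsub : ((Finset.Icc (-(m : ℤ)) m).filter fun n => (k : ℤ) ≤ |n|) ⊆
        Finset.Icc (-(m : ℤ)) (-k) ∪ Finset.Icc (k : ℤ) m := by
      intro n hn
      simp only [Finset.mem_filter, Finset.mem_Icc, Finset.mem_union, le_abs] at hn ⊢
      omega
    refine (Finset.card_le_card hsub).trans ((Finset.card_union_le _ _).trans ?_)
    rw [Int.card_Icc, Int.card_Icc]
    omega
  refine Finset.card_biUnion_le.trans ?_
  calc _ ≤ ∑ _i : Fin d, (2 * (m + 1 - k)) * (2 * m + 1) ^ (d - 1) := by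
        refine Finset.sum_le_sum fun i _ => ?_
        rw [Fintype.card_piFinset, ← Finset.mul_prod_erase _ _ (Finset.mem_univ i), if_pos rfl]
        refine Nat.mul_le_mul hF (le_of_eq ?_)
        rw [Finset.prod_congr rfl (g := fun _ => 2 * m + 1)
          (fun j hj => by rw [if_neg (Finset.ne_of_mem_erase hj), hI])]
        simp
    _ = _ := by simp [mul_assoc]

lemma exists_lattice_near {s : ℝ} (hs : 0 < s) (p : E d) :
    ∃ z : Lattice d, supDist p (s • latticePoint z) ≤ s / 2 := by
  refine ⟨fun i => round (p i / s), (supDist_le_iff (by positivity)).2 fun i => ?_⟩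
  have h := abs_sub_round (p i / s)
  have : p i - (s • latticePoint fun i => round (p i / s)) i =
      s * (p i / s - round (p i / s)) := by
    simp [latticePoint]
    field_simp
  rw [this, abs_mul, abs_of_pos hs]
  nlinarith

/-- Every point of the random set is close to a node of the grid of mesh `Δ / d` that is close to
the random set and linked to the point. -/
def GridLinked (t Δ : ℝ) (S : Set (E d)) : Prop :=
  ∀ p ∈ S, ∃ z : Lattice d, ∃ q ∈ S, dist q ((Δ / d) • latticePoint z) < t ∧
    dist q p ≤ 3 * Δ ∧ Link t S p q

/-- The constant in the covering of a sphere by balls. -/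
def shellConst (d : ℕ) : ℝ := d * (2 * (9 * d + 2)) * (5 * d) ^ (d - 1)

lemma shellConst_nonneg (d : ℕ) : 0 ≤ shellConst d := by unfold shellConst; positivity

/-- The chain is stopped on leaving the box of radius `3 w / 2`. The node attached to the stopping
point starts a chain back to `a`, of length at least `w / 2 - 3 Δ ≥ 7 w / 20`, which exceeds `r₀`.
-/
lemma exists_farLink_of_crossing (hd : 1 ≤ d) {t Δ r₀ w : ℝ} (ht : 0 < t) (htΔ : t ≤ Δ)
    (hr₀w : 20 * r₀ ≤ w) (hΔw : 20 * Δ ≤ w) {S : Set (E d)} (hS : GridLinked t Δ S)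
    (h : S ∈ crossing t 0 w) :
    ∃ z ∈ shell d (⌊3 / 2 * w * d / Δ⌋₊ - 4 * d) (⌊3 / 2 * w * d / Δ⌋₊ + 5 * d + 1),
      (fun x => -((Δ / d) • latticePoint z) + x) '' S ∈ farLink t r₀ := by
  have hΔ : 0 < Δ := ht.trans_le htΔ
  have hw : 0 < w := by linarith
  have hd' : (1 : ℝ) ≤ d := by exact_mod_cast hd
  obtain ⟨a, ha, b, hb, haw, hbw, -, hl⟩ := h
  obtain ⟨p, hp, hp1, hp2, hlp⟩ := (hl.mono inter_subset_left).exists_exit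
    (f := fun p => supDist p 0) (fun p q => supDist_le_supDist_add_dist 0 p q)
    (s := 3 / 2 * w) (by linarith) (by linarith)
  obtain ⟨z, q, hq, hqz, hqp, hlq⟩ := hS p hp
  set x : E d := (Δ / d) • latticePoint z with hx
  have hpx : supDist p x ≤ 4 * Δ := by
    have h1 := (supDist_le_dist p x).trans (dist_triangle_left p x q)
    linarith
  have hx0 : supDist x 0 = Δ / d * ‖z‖ := supDist_smul_latticePoint_zero (by positivity) z
  have h1 := supDist_triangle p x 0
  have h2 := supDist_triangle x p 0
  rw [supDist_comm x p] at h2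
  have hz : ‖z‖ = d / Δ * supDist x 0 := by rw [hx0]; field_simp
  have hlow : 3 / 2 * w * d / Δ - 4 * d ≤ ‖z‖ := by
    have : 3 / 2 * w * d / Δ - 4 * d = d / Δ * (3 / 2 * w - 4 * Δ) := by field_simp
    rw [this, hz]
    exact mul_le_mul_of_nonneg_left (by linarith) (by positivity)
  -- The margin `5 Δ` is `4 Δ` from the stopping point to the node plus an overshoot `t ≤ Δ`.
  have hup : ‖z‖ ≤ 3 / 2 * w * d / Δ + 5 * d := by
    have : 3 / 2 * w * d / Δ + 5 * d = d / Δ * (3 / 2 * w + 5 * Δ) := by field_simp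
    rw [this, hz]
    exact mul_le_mul_of_nonneg_left (by linarith) (by positivity)
  have hfl := Nat.floor_le (show 0 ≤ 3 / 2 * w * d / Δ by positivity)
  have hlf := Nat.lt_floor_add_one (3 / 2 * w * d / Δ)
  refine ⟨z, mem_shell hd ?_ ?_, -x + q, mem_image_of_mem _ hq, -x + a, mem_image_of_mem _ ha,
    ?_, ?_, (hlq.symm.trans (hlp.mono inter_subset_left).symm).image_add (-x)⟩
  · refine le_trans ?_ (max_le hlow (norm_nonneg z))
    -- The lower radius of the shell is a truncated subtraction, so it has to be compared with the
    -- positive part of the lower bound on `‖z‖`.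
    rcases le_total (4 * d) ⌊3 / 2 * w * d / Δ⌋₊ with h | h
    · rw [Nat.cast_sub h]
      refine le_max_of_le_left ?_
      push_cast
      linarith
    · rw [Nat.sub_eq_zero_of_le h]
      exact le_max_of_le_right (by simp)
  · push_cast
    linarith
  · rwa [neg_add_eq_sub, ← dist_eq_norm]
  · rw [dist_add_left]
    have h3 := dist_triangle_left p a q
    have h4 := supDist_le_supDist_add_dist 0 a p
    rw [dist_comm a p] at h4
    linarith

/-- The shell has thickness bounded in terms of `d` alone, so its cardinality grows with exponent `d
- 1`, matching the power of `r₀` in the percolation condition. -/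
lemma card_shell_floor_le (hd : 1 ≤ d) {Δ w : ℝ} (hΔ : 0 < Δ) (hΔw : 20 * Δ ≤ w) :
    ((shell d (⌊3 / 2 * w * d / Δ⌋₊ - 4 * d) (⌊3 / 2 * w * d / Δ⌋₊ + 5 * d + 1)).card : ℝ) ≤
      shellConst d * (w / Δ) ^ (d - 1) := by
  have hd' : (1 : ℝ) ≤ d := by exact_mod_cast hd
  have hwΔ : 20 ≤ w / Δ := (le_div_iff₀ hΔ).2 hΔw
  have hy : 3 / 2 * w * d / Δ = 3 / 2 * d * (w / Δ) := by ring
  set n := ⌊3 / 2 * w * d / Δ⌋₊ with hn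
  have hfl : (n : ℝ) ≤ 3 / 2 * d * (w / Δ) := by
    rw [← hy]
    exact Nat.floor_le (by rw [hy]; positivity)
  have hdn : 4 * d ≤ n := by
    refine Nat.le_floor ?_
    push_cast
    rw [hy]
    nlinarith
  have h := card_shell_le (d := d) (k := n - 4 * d) (m := n + 5 * d + 1) (by omega)
  have he : n + 5 * d + 1 + 1 - (n - 4 * d) = 9 * d + 2 := by omega
  rw [he] at h
  have h' : ((shell d (n - 4 * d) (n + 5 * d + 1)).card : ℝ) ≤
      d * (2 * (9 * d + 2)) * (2 * (n + 5 * d + 1) + 1) ^ (d - 1) := by exact_mod_cast h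
  refine h'.trans ?_
  rw [shellConst, mul_assoc _ ((5 * (d : ℝ)) ^ (d - 1)), ← mul_pow]
  have : (2 * ((n : ℝ) + 5 * d + 1) + 1) ≤ 5 * d * (w / Δ) := by nlinarith
  gcongr

namespace InclusionProcess

variable {Ω : Type*} [MeasurableSpace Ω] {P : Measure Ω}

lemma gridLinked_self (hd : 1 ≤ d) {Δ : ℝ} (hΔ : 0 < Δ) (S : Set (E d)) :
    GridLinked Δ Δ S := by
  intro p hp
  have hd' : (0 : ℝ) < d := by exact_mod_cast hd
  obtain ⟨z, hz⟩ := exists_lattice_near (s := Δ / d) (by positivity) p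
  refine ⟨z, p, hp, ?_, by simp [hΔ.le], Relation.ReflTransGen.refl⟩
  refine (dist_le_mul_supDist _ _).trans_lt ?_
  calc d * supDist p ((Δ / d) • latticePoint z) ≤ d * (Δ / d / 2) := by gcongr
    _ = Δ / 2 := by field_simp
    _ < Δ := by linarith

/-- If the ball of radius `δ` at `x` leaves `D`, then by connectedness it meets the frontier, and
the interior ball at a frontier point has its center within `2 δ` of `x`. -/
lemma _root_.ContinuumPercolation.InteriorBall.exists_ball {δ : ℝ} (hδ : 0 < δ) {D : Set (E d)}
    (hD : InteriorBall δ D) {x : E d} (hx : x ∈ D) :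
    ∃ y, Metric.ball y δ ⊆ D ∧ dist x y ≤ 2 * δ := by
  by_cases h : Metric.ball x δ ⊆ D
  · exact ⟨x, h, by simp [hδ.le]⟩
  · obtain ⟨u, hu, huD⟩ := not_subset.1 h
    obtain ⟨f, hf, hfD⟩ : ∃ f ∈ Metric.ball x δ, f ∈ frontier D := by
      by_contra hcon
      push Not at hcon
      have hxi : x ∈ interior D := by
        by_contra hxi
        exact hcon x (Metric.mem_ball_self hδ) ⟨subset_closure hx, hxi⟩
      have huc : u ∈ (closure D)ᶜ := fun huc => hcon u hu ⟨huc, fun h => huD (interior_subset h)⟩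
      obtain ⟨y, -, hyi, hyc⟩ := (convex_ball x δ).isPreconnected (interior D) (closure D)ᶜ
        isOpen_interior isClosed_closure.isOpen_compl
        (fun y hy => or_iff_not_imp_right.2 fun h => by
          by_contra hyi
          exact hcon y hy ⟨not_not.1 h, hyi⟩)
        ⟨x, Metric.mem_ball_self hδ, hxi⟩ ⟨u, hu, huc⟩
      exact hyc (interior_subset_closure hyi)
    obtain ⟨y, hy, hyD⟩ := hD f hfD
    refine ⟨y, hyD, ?_⟩
    have := dist_triangle_left x y f
    have h1 : dist f x < δ := hf
    linarith

/-- A ball of radius `δ` contains a node of the grid of mesh `δ / d`, so the node itself lies in the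
inclusion. The mesh is thus independent of `t`, which may tend to zero. -/
lemma Regular.gridLinked_of_interiorBall {𝓘 : InclusionProcess d P} {ω : Ω}
    (hω : 𝓘.Regular ω) (hd : 1 ≤ d) {t δ : ℝ} (ht : 0 < t) (hδ : 0 < δ)
    (hB : ∀ n, InteriorBall δ (𝓘.shape n ω)) : GridLinked t δ (𝓘.total ω) := by
  intro p hp
  have hd' : (0 : ℝ) < d := by exact_mod_cast hd
  obtain ⟨n, hn⟩ := mem_iUnion.1 hp
  obtain ⟨x, hx, rfl⟩ := id hn
  obtain ⟨y, hyD, hxy⟩ := (hB n).exists_ball hδ hx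
  obtain ⟨z, hz⟩ := exists_lattice_near (s := δ / d) (by positivity) (𝓘.center n ω + y)
  set q : E d := (δ / d) • latticePoint z with hq
  have hqy : dist (𝓘.center n ω + y) q ≤ δ / 2 := by
    refine (dist_le_mul_supDist _ _).trans ?_
    calc d * supDist (𝓘.center n ω + y) q ≤ d * (δ / d / 2) := by gcongr
      _ = δ / 2 := by field_simp
  have hqn : q ∈ 𝓘.incl n ω := by
    refine ⟨-𝓘.center n ω + q, hyD ?_, by simp⟩
    rw [Metric.mem_ball, ← dist_add_left (𝓘.center n ω), add_neg_cancel_left, dist_comm]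
    linarith
  have hqT := 𝓘.incl_subset_total n ω hqn
  refine ⟨z, q, hqT, by simpa [hq] using ht, ?_, ?_⟩
  · have h1 := dist_triangle_left q (𝓘.center n ω + x) (𝓘.center n ω + y)
    rw [dist_add_left, dist_comm y x] at h1
    linarith
  · exact Link.of_isPreconnected (hω.isConnected n).isPreconnected
      ((𝓘.incl_subset_total n ω).trans (Metric.self_subset_thickening (by linarith) _))
      ⟨hn, hp⟩ ⟨hqn, hqT⟩

variable [IsProbabilityMeasure P]

lemma crossing_le_of_gridLinked (𝓘 : InclusionProcess d P) (hH : ConditionH 𝓘) (hd : 1 ≤ d)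
    {t Δ r₀ w : ℝ} (ht : 0 < t) (htΔ : t ≤ Δ) (hr₀ : 0 ≤ r₀) (hr₀w : 20 * r₀ ≤ w)
    (hΔw : 20 * Δ ≤ w) (hS : ∀ᵐ ω ∂P, GridLinked t Δ (𝓘.total ω)) :
    P.real {ω | 𝓘.total ω ∈ crossing t 0 w} ≤
      shellConst d * (w / Δ) ^ (d - 1) * 𝓘.clusterTail t r₀ := by
  set s := shell d (⌊3 / 2 * w * d / Δ⌋₊ - 4 * d) (⌊3 / 2 * w * d / Δ⌋₊ + 5 * d + 1) with hs
  let A : Lattice d → Set Ω := fun z =>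
    {ω | (fun x => -((Δ / d) • latticePoint z) + x) '' 𝓘.total ω ∈ farLink t r₀}
  have hA : ∀ z, P.real (A z) ≤ 𝓘.clusterTail t r₀ := by
    intro z
    rw [measureReal_def, 𝓘.measure_image_add hH (testable_farLink ht r₀)]
    exact 𝓘.farLink_le_clusterTail ht hr₀
  calc P.real {ω | 𝓘.total ω ∈ crossing t 0 w} ≤ P.real (⋃ z ∈ s, A z) := by
        refine ENNReal.toReal_mono (measure_ne_top _ _) (measure_mono_ae ?_)
        filter_upwards [hS] with ω hω h
        obtain ⟨z, hz, hzf⟩ := exists_farLink_of_crossing hd ht htΔ hr₀w hΔw hω h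
        exact mem_biUnion hz hzf
    _ ≤ ∑ z ∈ s, P.real (A z) := measureReal_biUnion_finset_le _ _
    _ ≤ ∑ _z ∈ s, 𝓘.clusterTail t r₀ := Finset.sum_le_sum fun z _ => hA z
    _ = s.card * 𝓘.clusterTail t r₀ := by simp
    _ ≤ _ := mul_le_mul_of_nonneg_right (card_shell_floor_le hd (ht.trans_le htΔ) hΔw)
        measureReal_nonneg

/-- The percolation condition controls the crossing probabilities at large scales. -/
lemma exists_crossing_le (𝓘 : InclusionProcess d P) (hH : ConditionH 𝓘) (hd : 1 ≤ d)
    {Λ L : ℝ} (hΛ : 1 ≤ Λ) (hL : 1 ≤ L) (hP : ConditionPerc 𝓘 Λ L) :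
    ∃ t r₀ : ℝ, 0 < t ∧ t ≤ Λ ∧ 1 / Λ ≤ r₀ ∧ ∀ m : ℝ, 20 * Λ ^ 2 ≤ m →
      P.real {ω | 𝓘.total ω ∈ crossing t 0 (m * r₀)} ≤
        2 * shellConst d * m ^ (d - 1) * Λ / L := by
  obtain ⟨t, Δ, r₀, ht, htΔ, hΔΛ, hr₀, hgrid, htail⟩ : ∃ t Δ r₀ : ℝ, 0 < t ∧ t ≤ Δ ∧ Δ ≤ Λ ∧
      1 / Λ ≤ r₀ ∧ (∀ᵐ ω ∂P, GridLinked t Δ (𝓘.total ω)) ∧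
      r₀ ^ (d - 1) * 𝓘.clusterTail t r₀ ≤ 2 * (1 / L * Δ ^ d) := by
    rcases hP with ⟨h₀, r₀, hh₀, hh₀Λ, hr₀, h⟩ | ⟨δ, hδ, hδΛ, hball, r₀, hr₀, h⟩
    · refine ⟨h₀, h₀, r₀, hh₀, le_rfl, hh₀Λ, hr₀,
        Eventually.of_forall fun ω => gridLinked_self hd hh₀ _, h.trans ?_⟩
      have : 0 ≤ 1 / L * h₀ ^ d := by positivity
      linarith
    · have hr₀' : 0 < r₀ := lt_of_lt_of_le (by positivity) hr₀
      -- The factor 2 turns the bound on the limsup into a strict one, so that it passes to some `t`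
      -- in `(0, δ)`.
      have hlim : limsup (fun h => 𝓘.clusterTail h r₀) (𝓝[>] (0 : ℝ)) <
          2 * (1 / L * δ ^ d) / r₀ ^ (d - 1) := by
        rw [lt_div_iff₀ (by positivity), mul_comm]
        refine h.trans_lt ?_
        have : 0 < 1 / L * δ ^ d := by positivity
        linarith
      have hev := eventually_lt_of_limsup_lt hlim
        (isBoundedUnder_of ⟨1, fun h => measureReal_le_one⟩)
      obtain ⟨t, htl, ht, htδ⟩ := (hev.and (Ioo_mem_nhdsGT hδ)).exists
      refine ⟨t, δ, r₀, ht, htδ.le, hδΛ, hr₀, ?_, ?_⟩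
      · filter_upwards [𝓘.ae_regular, hball] with ω hω hω'
        exact hω.gridLinked_of_interiorBall hd ht hδ hω'
      · rw [mul_comm]
        exact ((lt_div_iff₀ (by positivity)).1 htl).le
  have hr₀' : 0 < r₀ := lt_of_lt_of_le (by positivity) hr₀
  have hΔ : 0 < Δ := ht.trans_le htΔ
  refine ⟨t, r₀, ht, htΔ.trans hΔΛ, hr₀, fun m hm => ?_⟩
  have hm20 : 20 ≤ m := by nlinarith
  have hmr : 20 * Λ ≤ m * r₀ := by
    calc 20 * Λ = 20 * Λ ^ 2 * (1 / Λ) := by field_simp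
      _ ≤ m * r₀ := by gcongr
  refine (𝓘.crossing_le_of_gridLinked hH hd ht htΔ hr₀'.le
    (mul_le_mul_of_nonneg_right hm20 hr₀'.le) (by linarith) hgrid).trans ?_
  obtain ⟨k, rfl⟩ : ∃ k, d = k + 1 := ⟨d - 1, by omega⟩
  simp only [Nat.add_sub_cancel] at htail ⊢
  -- The powers of `r₀` are absorbed by the percolation condition and those of `Δ` cancel up to one
  -- factor `Δ ≤ Λ`. The bound does not involve `r₀`, which has no upper bound.
  calc shellConst (k + 1) * (m * r₀ / Δ) ^ k * 𝓘.clusterTail t r₀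
      = shellConst (k + 1) * (m / Δ) ^ k * (r₀ ^ k * 𝓘.clusterTail t r₀) := by
        rw [div_pow, div_pow, mul_pow]; ring
    _ ≤ shellConst (k + 1) * (m / Δ) ^ k * (2 * (1 / L * Δ ^ (k + 1))) := by
        have := shellConst_nonneg (k + 1)
        gcongr
    _ = 2 * shellConst (k + 1) * m ^ k * Δ / L := by
        rw [div_pow, pow_succ]; field_simp
    _ ≤ 2 * shellConst (k + 1) * m ^ k * Λ / L := by
        have := shellConst_nonneg (k + 1)
        gcongr

end InclusionProcess

/-! ### Renormalization over separated annuli -/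

/-- A translation covariant family of local events that renormalizes: if the event occurs at scale
`20 N w` at the origin, it occurs at scale `w` at a grid point of each of `N` annuli. -/
structure Renormalizable (N : ℕ) (w₁ : ℝ) (bad : E d → ℝ → Set (Set (E d))) : Prop where
  testable : ∀ x w, Testable (bad x w)
  dependsOnlyOn : ∀ x w, DependsOnlyOn (bad x w) (supBall x (3 * w))
  image_add : ∀ z x w S, S ∈ bad x w → (fun p => z + p) '' S ∈ bad (z + x) w
  renorm : ∀ w S, w₁ ≤ w → S ∈ bad 0 (20 * N * w) → ∀ j < N, ∃ z : Lattice d,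
    (20 * N + 12 * j + 4 : ℝ) ≤ ‖z‖ ∧ ‖z‖ ≤ 20 * N + 12 * j + 8 ∧ S ∈ bad (w • latticePoint z) w

/-- For each `j`, the chain is stopped past radius `s = (20 N + 12 j + 6) w`, and `z` is the nearest
node. Run backwards from there, it must reach `a`, at distance more than `2 w` from the node, so it
crosses the small box. Rounding by `w / 2` and overshoot `t ≤ w` keep the node within `2 w` of
radius `s`. -/
lemma renormalizable_crossing (N : ℕ) {t : ℝ} (ht : 0 < t) :
    Renormalizable N t (crossing t : E d → ℝ → Set (Set (E d))) := by
  refine ⟨testable_crossing ht, dependsOnlyOn_crossing t, fun _ _ _ _ => crossing_image_add, ?_⟩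
  rintro w S htw ⟨a, ha, b, hb, haw, hbw, -, hl⟩ j hj
  have hw : 0 < w := ht.trans_le htw
  have hj' : (j : ℝ) + 1 ≤ N := by exact_mod_cast hj
  have hj0 : (0 : ℝ) ≤ j := j.cast_nonneg
  set s : ℝ := (20 * N + 12 * j + 6) * w with hs
  have hNw : 20 * N * w ≤ s := by rw [hs]; nlinarith
  have hsb : s < 2 * (20 * N * w) := by rw [hs]; nlinarith
  have hl' := hl.mono inter_subset_left
  obtain ⟨p, hp, hp1, hp2, hlp⟩ := hl'.exists_exit
    (f := fun p => supDist p 0) (fun p q => supDist_le_supDist_add_dist 0 p q)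
    (s := s) (by linarith) (by linarith)
  obtain ⟨z, hz⟩ := exists_lattice_near hw p
  set x : E d := w • latticePoint z with hx
  have hx0 : supDist x 0 = w * ‖z‖ := supDist_smul_latticePoint_zero hw.le z
  have h1 := supDist_triangle p x 0
  have h2 := supDist_triangle x p 0
  rw [supDist_comm x p] at h2
  have h3 := supDist_triangle x a 0
  rw [supDist_comm x a] at h3
  have hja : 0 ≤ j * w := by positivity
  have hax : 2 * w < supDist a x := by nlinarith
  obtain ⟨q, hq, hq1, hq2, hlq⟩ := ((hlp.mono inter_subset_left).symm).exists_exit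
    (f := fun p => supDist p x) (fun p q => supDist_le_supDist_add_dist x p q)
    (s := 2 * w) (by linarith) hax
  refine ⟨z, ?_, ?_, p, hp, q, hq, by linarith, hq1, by linarith, hlq.mono ?_⟩
  · refine le_of_mul_le_mul_left ?_ hw
    nlinarith
  · refine le_of_mul_le_mul_left ?_ hw
    nlinarith
  · refine inter_subset_inter_right _ fun y hy => ?_
    simp only [mem_ofPred_eq, supBall] at hy ⊢
    linarith

/-- A vacant box contains smaller vacant boxes: a node on the diagonal at radius `20 N + 12 j + 6`,
enlarged by 3, stays below `60 N`. -/
lemma renormalizable_vacant (hd : 1 ≤ d) (N : ℕ) :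
    Renormalizable N 0 (vacant : E d → ℝ → Set (Set (E d))) := by
  refine ⟨testable_vacant, dependsOnlyOn_vacant, fun _ _ _ _ => vacant_image_add, ?_⟩
  intro w S hw hS j hj
  have hj' : (j : ℝ) + 1 ≤ N := by exact_mod_cast hj
  have hj0 : (0 : ℝ) ≤ j := j.cast_nonneg
  have : Nonempty (Fin d) := ⟨⟨0, hd⟩⟩
  let z : Lattice d := fun _ => 20 * N + 12 * j + 6
  have hz : ‖z‖ = 20 * N + 12 * j + 6 := by
    rw [pi_norm_const, Int.norm_eq_abs]
    push_cast
    exact abs_of_nonneg (by positivity)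
  refine ⟨z, by rw [hz]; linarith, by rw [hz]; linarith, fun p hp => ?_⟩
  have h1 := hS p hp
  have h2 := supDist_triangle p (w • latticePoint z) 0
  rw [supDist_smul_latticePoint_zero hw, hz] at h2
  nlinarith

/-- The total influence of the random field on local events at scale `w`. -/
def influenceSum (d N : ℕ) (tail : ℝ → ℝ) (w : ℝ) : ENNReal :=
  ∑' z : Lattice d, ENNReal.ofReal (tail (max w (‖z‖ / (41 * N))))

section

variable {Ω : Type u} [MeasurableSpace Ω] {P : Measure Ω} {𝓘 : InclusionProcess d P}
  {tail : ℝ → ℝ} {N : ℕ}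

lemma Renormalizable.measure_le {w₁ : ℝ} {bad : E d → ℝ → Set (Set (E d))}
    (hb : Renormalizable N w₁ bad) (hH : ConditionH 𝓘) (x : E d) (w : ℝ) :
    P {ω | 𝓘.total ω ∈ bad x w} ≤ P {ω | 𝓘.total ω ∈ bad 0 w} := by
  rw [← 𝓘.measure_image_add hH (hb.testable 0 w) (-x)]
  refine measure_mono fun ω hω => ?_
  simpa using hb.image_add (-x) x w _ hω

variable [IsProbabilityMeasure P]

/-- Sites are sorted at radius `a + w`, the middle of the corridor of width `2 w` between the two
regions. Outer sites are at distance at least `‖z‖ - a`, which dominates both `w` and `‖z‖ / (41 N)`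
since `a ≤ 40 N w`; inner sites satisfy `‖z‖ ≤ 41 N w`, so for them the maximum is `w`. -/
lemma HasActionRadii.measure_annuli_le (h : HasActionRadii.{u, v} 𝓘 tail) (hN : 1 ≤ N)
    {A B : Set (Set (E d))} (hA : Testable A) (hB : Testable B) {a w : ℝ} (hw : 0 < w)
    (ha : a ≤ 40 * N * w) (hAa : DependsOnlyOn A (supBall 0 a))
    (hBa : DependsOnlyOn B {p | a + 2 * w < supDist p 0}) :
    P {ω | 𝓘.total ω ∈ A ∩ B} ≤
      P {ω | 𝓘.total ω ∈ A} * P {ω | 𝓘.total ω ∈ B} + influenceSum d N tail w := by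
  obtain ⟨D, hDc, hD⟩ := TopologicalSpace.exists_countable_dense (E d)
  have hN' : (1 : ℝ) ≤ N := by exact_mod_cast hN
  have hlat : ∀ z : Lattice d, supDist (latticePoint z) 0 = ‖z‖ := fun z => by
    simpa using supDist_smul_latticePoint_zero zero_le_one z
  rw [𝓘.measure_eq_of_testable (hA.inter hB) hD, 𝓘.measure_eq_of_testable hA hD,
    𝓘.measure_eq_of_testable hB hD]
  refine h.measure_inter_le (hA.measurable D hDc) (hB.measurable D hDc) (hAa.restrict D)
    (hBa.restrict D) (fun z => max w (‖z‖ / (41 * N))) (fun z => lt_max_of_lt_left hw)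
    {z | ‖z‖ < a + w} (fun z hz => ?_) (fun z hz => ?_)
  · rw [Set.disjoint_left]
    intro p hp hpb
    have hp' : supDist p 0 < a := hp
    have h1 := supDist_le_supDist_add_dist 0 p (latticePoint z)
    rw [hlat] at h1
    have hz' : a + w ≤ ‖z‖ := not_lt.1 hz
    have h2 : ‖z‖ / (41 * N) ≤ ‖z‖ - a := by
      rw [div_le_iff₀ (by positivity)]
      nlinarith
    have h3 : dist p (latticePoint z) < ‖z‖ - a :=
      lt_of_lt_of_le hpb (max_le (by linarith) h2)
    linarith
  · rw [Set.disjoint_left]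
    intro p hp hpb
    have hp' : a + 2 * w < supDist p 0 := hp
    have h1 := supDist_le_supDist_add_dist 0 (latticePoint z) p
    rw [hlat, dist_comm] at h1
    have hz' : ‖z‖ < a + w := hz
    have h2 : ‖z‖ / (41 * N) ≤ w := by
      rw [div_le_iff₀ (by positivity)]
      nlinarith
    have h3 : dist p (latticePoint z) < w := lt_of_lt_of_le hpb (max_le le_rfl h2)
    linarith

/-- The grid points in the annulus of index `j`. -/
def annulus (d N j : ℕ) : Finset (Lattice d) :=
  (Fintype.piFinset fun _ => Finset.Icc (-(40 * N : ℤ)) (40 * N)).filter fun z =>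
    (20 * N + 12 * j + 4 : ℝ) ≤ ‖z‖ ∧ ‖z‖ ≤ 20 * N + 12 * j + 8

lemma card_annulus_le (j : ℕ) : (annulus d N j).card ≤ (80 * N + 1) ^ d := by
  refine (Finset.card_filter_le _ _).trans ?_
  rw [Fintype.card_piFinset_const, Int.card_Icc]
  refine le_of_eq ?_
  congr 1
  omega

lemma mem_annulus {j : ℕ} (hj : j < N) {z : Lattice d} (h1 : (20 * N + 12 * j + 4 : ℝ) ≤ ‖z‖)
    (h2 : ‖z‖ ≤ 20 * N + 12 * j + 8) : z ∈ annulus d N j := by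
  refine Finset.mem_filter.2 ⟨Fintype.mem_piFinset.2 fun i => Finset.mem_Icc.2 (abs_le.1 ?_),
    h1, h2⟩
  have hj' : (j : ℝ) + 1 ≤ N := by exact_mod_cast hj
  have h3 : ((|z i| : ℤ) : ℝ) ≤ 40 * N := (abs_le_norm z i).trans (by linarith)
  exact_mod_cast h3

lemma Renormalizable.measure_renorm_le {w₁ : ℝ} {bad : E d → ℝ → Set (Set (E d))}
    (hb : Renormalizable N w₁ bad) (hH : ConditionH 𝓘) (h : HasActionRadii.{u, v} 𝓘 tail)
    (hN : 1 ≤ N) {w : ℝ} (hw : 0 < w) (hw₁ : w₁ ≤ w) :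
    P {ω | 𝓘.total ω ∈ bad 0 (20 * N * w)} ≤
      (((80 * N + 1) ^ d : ℕ) * P {ω | 𝓘.total ω ∈ bad 0 w}) ^ N +
        N * influenceSum d N tail w := by
  -- `A j` asks for a bad box in annulus `j`, `C j` for one in each of the first `j` annuli.
  -- Independence is used once per annulus, peeling `A j` off `C (j + 1)`.
  let A : ℕ → Set (Set (E d)) := fun j => ⋃ z ∈ annulus d N j, bad (w • latticePoint z) w
  let C : ℕ → Set (Set (E d)) := fun j => {S | ∀ i < j, S ∈ A i}
  have hC : ∀ j, C (j + 1) = C j ∩ A j := fun j => by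
    ext S
    simp only [C, mem_ofPred_eq, mem_inter_iff, Nat.lt_succ_iff_lt_or_eq]
    exact ⟨fun h => ⟨fun i hi => h i (Or.inl hi), h j (Or.inr rfl)⟩,
      fun h i hi => hi.elim (h.1 i) fun e => e ▸ h.2⟩
  have hC0 : C 0 = univ := by ext S; simp [C]
  have hAt : ∀ j, Testable (A j) := fun j => Testable.biUnion fun z _ => hb.testable _ _
  have hCt : ∀ j, Testable (C j) := fun j => by
    induction j with
    | zero => rw [hC0]; exact testable_univ
    | succ j ih => rw [hC]; exact ih.inter (hAt j)
  have hsup : ∀ z : Lattice d, supDist (w • latticePoint z) 0 = w * ‖z‖ := fun z =>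
    supDist_smul_latticePoint_zero hw.le z
  -- Nodes of annulus `j` reach offset `12 j + 8` and boxes add 3, giving `12 (j + 1) - 1`; the next
  -- annulus starts at offset `12 (j + 1) + 4 - 3`. The gap is the required `2 w`.
  have hAin : ∀ j, DependsOnlyOn (A j) (supBall 0 (w * (20 * N + 12 * (j + 1 : ℕ) - 1))) := by
    refine fun j => DependsOnlyOn.biUnion fun z hz => (hb.dependsOnlyOn _ _).mono fun p hp => ?_
    have h1 := supDist_triangle p (w • latticePoint z) 0
    have h2 := (Finset.mem_filter.1 hz).2.2
    rw [hsup] at h1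
    simp only [supBall, mem_ofPred_eq] at hp ⊢
    push_cast
    nlinarith
  have hAout : ∀ j : ℕ, DependsOnlyOn (A j)
      {p | w * (20 * N + 12 * j - 1) + 2 * w < supDist p 0} := by
    refine fun j => DependsOnlyOn.biUnion fun z hz => (hb.dependsOnlyOn _ _).mono fun p hp => ?_
    have h1 := supDist_triangle (w • latticePoint z) p 0
    have h2 := (Finset.mem_filter.1 hz).2.1
    rw [hsup, supDist_comm] at h1
    simp only [supBall, mem_ofPred_eq] at hp ⊢
    nlinarith
  have hCin : ∀ j : ℕ, DependsOnlyOn (C j) (supBall 0 (w * (20 * N + 12 * j - 1))) := fun j => by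
    induction j with
    | zero => rw [hC0]; exact fun _ _ _ => by simp
    | succ j ih =>
      rw [hC]
      refine (ih.mono fun p hp => ?_).inter (hAin j)
      simp only [supBall, mem_ofPred_eq] at hp ⊢
      push_cast
      nlinarith
  set u := P {ω | 𝓘.total ω ∈ bad 0 w} with hu
  have hAu : ∀ j, P {ω | 𝓘.total ω ∈ A j} ≤ ((80 * N + 1) ^ d : ℕ) * u := by
    intro j
    have : {ω | 𝓘.total ω ∈ A j} =
        ⋃ z ∈ annulus d N j, {ω | 𝓘.total ω ∈ bad (w • latticePoint z) w} := by
      ext ω; simp [A]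
    rw [this]
    calc _ ≤ ∑ z ∈ annulus d N j, P {ω | 𝓘.total ω ∈ bad (w • latticePoint z) w} :=
          measure_biUnion_finset_le _ _
      _ ≤ ∑ _z ∈ annulus d N j, u := Finset.sum_le_sum fun z _ => hb.measure_le hH _ _
      _ = (annulus d N j).card * u := by simp
      _ ≤ _ := by gcongr; exact card_annulus_le j
  have hCj : ∀ j ≤ N, P {ω | 𝓘.total ω ∈ C j} ≤
      (((80 * N + 1) ^ d : ℕ) * u) ^ j + j * influenceSum d N tail w := by
    intro j
    induction j with
    | zero => intro _; simpa using prob_le_one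
    | succ j ih =>
      intro hj
      have hj' : (j : ℝ) + 1 ≤ N := by exact_mod_cast hj
      rw [hC]
      refine (h.measure_annuli_le hN (hCt j) (hAt j) hw (a := w * (20 * N + 12 * j - 1))
        (by nlinarith) (hCin j) (hAout j)).trans ?_
      calc _ ≤ ((((80 * N + 1) ^ d : ℕ) * u) ^ j + j * influenceSum d N tail w) *
            P {ω | 𝓘.total ω ∈ A j} + influenceSum d N tail w := by
            gcongr; exact ih (by omega)
        _ ≤ (((80 * N + 1) ^ d : ℕ) * u) ^ j * (((80 * N + 1) ^ d : ℕ) * u) +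
            j * influenceSum d N tail w * 1 + influenceSum d N tail w := by
            rw [add_mul]
            gcongr
            · exact hAu j
            · exact prob_le_one
        _ = _ := by push_cast; ring
  refine le_trans (measure_mono fun ω hω => ?_) (hCj N le_rfl)
  intro j hj
  obtain ⟨z, hz1, hz2, hz⟩ := hb.renorm w _ hw₁ hω j hj
  exact mem_biUnion (mem_annulus hj hz1 hz2) hz

lemma Renormalizable.measureReal_renorm_le {w₁ : ℝ} {bad : E d → ℝ → Set (Set (E d))}
    (hb : Renormalizable N w₁ bad) (hH : ConditionH 𝓘) (h : HasActionRadii.{u, v} 𝓘 tail)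
    (hN : 1 ≤ N) {w : ℝ} (hw : 0 < w) (hw₁ : w₁ ≤ w) {e : ℝ} (he : 0 ≤ e)
    (hsum : influenceSum d N tail w ≤ ENNReal.ofReal e) :
    P.real {ω | 𝓘.total ω ∈ bad 0 (20 * N * w)} ≤
      ((80 * N + 1 : ℝ) ^ d * P.real {ω | 𝓘.total ω ∈ bad 0 w}) ^ N + N * e := by
  refine ENNReal.toReal_le_of_le_ofReal (by positivity)
    ((hb.measure_renorm_le hH h hN hw hw₁).trans ?_)
  rw [ENNReal.ofReal_add (by positivity) (by positivity), ENNReal.ofReal_pow (by positivity),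
    ENNReal.ofReal_mul (by positivity), ofReal_measureReal, ENNReal.ofReal_mul (by positivity),
    ENNReal.ofReal_natCast]
  have : ENNReal.ofReal ((80 * N + 1 : ℝ) ^ d) = (((80 * N + 1) ^ d : ℕ) : ENNReal) := by
    rw [← ENNReal.ofReal_natCast]
    push_cast
    rfl
  rw [this]
  gcongr

end

/-- Large boxes are rarely vacant. -/
lemma InclusionProcess.exists_vacant_le {Ω : Type*} [MeasurableSpace Ω] {P : Measure Ω}
    [IsProbabilityMeasure P] (𝓘 : InclusionProcess d P) (hH : ConditionH 𝓘) {ε : ℝ} (hε : 0 < ε)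
    (R₁ : ℝ) : ∃ R, R₁ ≤ R ∧ P.real {ω | 𝓘.total ω ∈ vacant 0 R} ≤ ε := by
  obtain ⟨D, hDc, hD⟩ := TopologicalSpace.exists_countable_dense (E d)
  let V : ℕ → Set Ω := fun n => {ω | 𝓘.total ω ∈ vacant 0 (n : ℝ)}
  -- Almost everywhere measurability of the random set is part of the identity in distribution.
  have hT : AEMeasurable 𝓘.total P := (hH.inclusions.stationary 0).aemeasurable_snd
  have hV : ∀ n, NullMeasurableSet (V n) P := by
    intro n
    refine (hT.nullMeasurable ((testable_vacant 0 (n : ℝ)).measurable D hDc)).congr ?_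
    filter_upwards [𝓘.ae_regular] with ω hω
    exact propext ((testable_vacant 0 (n : ℝ)).dense D hD _ hω.isOpen_total)
  have hanti : Antitone V := by
    intro n m hnm ω hω p hp
    have h1 := hω p hp
    have h2 : (n : ℝ) ≤ m := by exact_mod_cast hnm
    linarith
  have h0 : P (⋂ n, V n) = 0 := by
    refine measure_mono_null (t := {ω | ¬ 𝓘.Regular ω}) (fun ω hω hreg => ?_)
      (ae_iff.1 𝓘.ae_regular)
    obtain ⟨p, hp⟩ := hreg.total_nonempty
    obtain ⟨n, hn⟩ := exists_nat_gt (supDist p 0)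
    have h1 := mem_iInter.1 hω n p hp
    linarith [supDist_nonneg p 0]
  have hlim := tendsto_measure_iInter_atTop (μ := P) hV hanti ⟨0, measure_ne_top _ _⟩
  rw [h0] at hlim
  have hev := (hlim.eventually_le_const (ENNReal.ofReal_pos.2 hε)).and
    (eventually_ge_atTop ⌈R₁⌉₊)
  obtain ⟨n, hn, hnR⟩ := hev.exists
  exact ⟨n, Nat.ceil_le.1 hnR, ENNReal.toReal_le_of_le_ofReal hε.le hn⟩

/-! ### Tail families and the recursion along scales -/

/-- The properties of a family of tails, indexed by a constant, that make estimates along a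
geometric sequence of scales sufficient. -/
structure TailFamily (ψ : ℝ → ℝ → ℝ) : Prop where
  nonneg : ∀ C, 0 < C → ∀ r, 0 < r → 0 ≤ ψ C r
  antitone : ∀ C, 0 < C → ∀ r r', 0 < r → r ≤ r' → ψ C r' ≤ ψ C r
  scale : ∀ C c, 0 < C → 0 < c → ∃ C', 0 < C' ∧ ∀ r, 0 < r → ψ C (c * r) ≤ ψ C' r
  add : ∀ C C', 0 < C → 0 < C' → ∃ C'', 0 < C'' ∧ ∀ r, 0 < r → ψ C r + ψ C' r ≤ ψ C'' r
  one : ∀ R, ∃ C, 0 < C ∧ ∀ r, 0 < r → r ≤ R → 1 ≤ ψ C r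

/-- Between consecutive scales monotonicity loses a factor `l` in the argument, absorbed by `scale`;
values `r ≤ R` are absorbed by `one`. -/
lemma TailFamily.of_geometric {ψ : ℝ → ℝ → ℝ} (hψ : TailFamily ψ) {g : ℝ → ℝ} (hg : Antitone g)
    (hg1 : ∀ r, g r ≤ 1) {l R A : ℝ} (hl : 1 < l) (hR : 0 < R) (hA : 0 < A)
    (h : ∀ k : ℕ, g (l ^ k * R) ≤ ψ A (l ^ k * R)) :
    ∃ C, 0 < C ∧ ∀ r, 0 < r → g r ≤ ψ C r := by
  obtain ⟨B, hB, hB'⟩ := hψ.scale A (1 / l) hA (by positivity)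
  obtain ⟨B₁, hB₁, hB₁'⟩ := hψ.one R
  obtain ⟨C, hC, hC'⟩ := hψ.add B B₁ hB hB₁
  refine ⟨C, hC, fun r hr => le_trans ?_ (hC' r hr)⟩
  rcases le_total r R with hrR | hrR
  · linarith [hg1 r, hB₁' r hr hrR, hψ.nonneg B hB r hr]
  · obtain ⟨k, hk, hk'⟩ := exists_nat_pow_near ((one_le_div hR).2 hrR) hl
    have h1 : l ^ k * R ≤ r := (le_div_iff₀ hR).1 hk
    have h2 : r < l ^ (k + 1) * R := (div_lt_iff₀ hR).1 hk'
    have h3 : 1 / l * r ≤ l ^ k * R := by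
      rw [div_mul_eq_mul_div, one_mul, div_le_iff₀ (by linarith)]
      calc r ≤ l ^ (k + 1) * R := h2.le
        _ = l ^ k * R * l := by ring
    have h4 : 0 < 1 / l * r := by positivity
    linarith [hg h1, h k, hψ.antitone A hA _ _ h4 h3, hB' r hr, hψ.nonneg B₁ hB₁ r hr]

lemma tailFamily_rpow {κ : ℝ} (hκ : 0 < κ) : TailFamily fun C r => C * r ^ (-κ) where
  nonneg C hC r hr := by positivity
  antitone C hC r r' hr hrr' :=
    mul_le_mul_of_nonneg_left (Real.rpow_le_rpow_of_nonpos hr hrr' (by linarith)) hC.le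
  scale C c hC hc := ⟨C * c ^ (-κ), by positivity, fun r hr => by
    rw [Real.mul_rpow hc.le hr.le, mul_assoc]⟩
  add C C' hC hC' := ⟨C + C', by positivity, fun r hr => by rw [add_mul]⟩
  one R := by
    refine ⟨(max R 1) ^ κ, by positivity, fun r hr hrR => ?_⟩
    rw [Real.rpow_neg hr.le, ← div_eq_mul_inv, one_le_div (by positivity)]
    exact Real.rpow_le_rpow hr.le (hrR.trans (le_max_left _ _)) hκ.le

lemma tailFamily_exp {γ : ℝ} (hγ : 0 < γ) :
    TailFamily fun C r => C * Real.exp (-(1 / C) * r ^ γ) where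
  nonneg C hC r hr := by positivity
  antitone C hC r r' hr hrr' := by
    have h1 : r ^ γ ≤ r' ^ γ := Real.rpow_le_rpow hr.le hrr' hγ.le
    have h2 : 0 < 1 / C := by positivity
    refine mul_le_mul_of_nonneg_left (Real.exp_le_exp.2 ?_) hC.le
    nlinarith
  scale C c hC hc := by
    refine ⟨max C (C / c ^ γ), lt_max_of_lt_left hC, fun r hr => ?_⟩
    have hm : 0 < max C (C / c ^ γ) := lt_max_of_lt_left hC
    refine mul_le_mul (le_max_left _ _) (Real.exp_le_exp.2 ?_) (Real.exp_pos _).le hm.le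
    rw [Real.mul_rpow hc.le hr.le, ← mul_assoc]
    refine mul_le_mul_of_nonneg_right ?_ (by positivity)
    have hcγ : 0 < c ^ γ := by positivity
    have : 1 / max C (C / c ^ γ) ≤ 1 / (C / c ^ γ) :=
      one_div_le_one_div_of_le (by positivity) (le_max_right _ _)
    have h2 : 1 / (C / c ^ γ) = 1 / C * c ^ γ := by field_simp
    linarith
  add C C' hC hC' := ⟨C + C', by positivity, fun r hr => by
    have hx : 0 ≤ r ^ γ := by positivity
    have e : ∀ a, 0 < a → a ≤ C + C' →
        a * Real.exp (-(1 / a) * r ^ γ) ≤ a * Real.exp (-(1 / (C + C')) * r ^ γ) := by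
      intro a ha haC
      have : 1 / (C + C') ≤ 1 / a := one_div_le_one_div_of_le ha haC
      refine mul_le_mul_of_nonneg_left (Real.exp_le_exp.2 ?_) ha.le
      nlinarith
    have h1 := e C hC (by linarith)
    have h2 := e C' hC' (by linarith)
    rw [add_mul]
    linarith⟩
  one R := by
    -- With `C ≥ r ^ γ` the exponential is at least `exp (-1)`, and `C ≥ exp 1` compensates it.
    refine ⟨max (Real.exp 1) (max R 1 ^ γ), lt_max_of_lt_left (Real.exp_pos _),
      fun r hr hrR => ?_⟩
    set C := max (Real.exp 1) (max R 1 ^ γ) with hC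
    have hC0 : 0 < C := lt_max_of_lt_left (Real.exp_pos _)
    have h1 : r ^ γ ≤ C :=
      (Real.rpow_le_rpow hr.le (hrR.trans (le_max_left _ _)) hγ.le).trans (le_max_right _ _)
    have h2 : -1 ≤ -(1 / C) * r ^ γ := by
      have : 1 / C * r ^ γ ≤ 1 := by
        rw [div_mul_eq_mul_div, one_mul]; exact (div_le_one hC0).2 h1
      linarith
    calc (1 : ℝ) = Real.exp 1 * Real.exp (-1) := by rw [← Real.exp_add]; simp
      _ ≤ C * Real.exp (-(1 / C) * r ^ γ) :=
        mul_le_mul (le_max_left _ _) (Real.exp_le_exp.2 h2) (Real.exp_pos _).le hC0.le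

/-- A renormalization inequality with small initial value propagates the tail of the error. -/
def Propagates (N : ℕ) (K : ℝ) (err : ℝ → ℝ) (ψ : ℝ → ℝ → ℝ) : Prop :=
  ∃ ε R₁ : ℝ, 0 < ε ∧ ∀ R, R₁ ≤ R → 1 ≤ R → ∀ u : ℝ → ℝ, (∀ w, 0 ≤ u w) →
    (∀ w, R ≤ w → u (20 * N * w) ≤ (K * u w) ^ N + N * err w) → u R ≤ ε →
    ∃ A, 0 < A ∧ ∀ k : ℕ, u ((20 * N) ^ k * R) ≤ ψ A ((20 * N) ^ k * R)

lemma pow_mul_rpow_neg {l R : ℝ} (hl : 0 < l) (hR : 0 < R) (κ : ℝ) (k : ℕ) :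
    (l ^ k * R) ^ (-κ) = (l ^ (-κ)) ^ k * R ^ (-κ) := by
  rw [Real.mul_rpow (by positivity) hR.le, ← Real.rpow_natCast, ← Real.rpow_mul hl.le,
    mul_comm (k : ℝ), Real.rpow_mul hl.le, Real.rpow_natCast]

/-- Ansatz `u (40 ^ k * R) ≤ ε * ρ ^ k` with `ρ = 40 ^ (-κ)`. The square leaves a spare factor `ε`,
so half of `ε * ρ ^ (k + 1)` covers it, and the other half covers the error once `R ≥ R₁`. Both `ε`
and `R₁` are fixed before `R` and `u`. -/
lemma propagates_rpow {K C κ : ℝ} (hK : 0 ≤ K) (hκ : 0 < κ) :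
    Propagates 2 K (fun w => C * w ^ (-κ)) fun C r => C * r ^ (-κ) := by
  set ρ : ℝ := 40 ^ (-κ) with hρ
  have hρ0 : 0 < ρ := by positivity
  have hρ1 : ρ ≤ 1 := Real.rpow_le_one_of_one_le_of_nonpos (by norm_num) (by linarith)
  set ε : ℝ := ρ / (2 * (K ^ 2 + 1)) with hε
  have hε0 : 0 < ε := by positivity
  have hKε : K ^ 2 * ε ≤ ρ / 2 := by
    rw [hε, ← mul_div_assoc, div_le_div_iff₀ (by positivity) (by norm_num)]
    nlinarith [sq_nonneg K]
  have hlim : Tendsto (fun R : ℝ => 2 * (C * R ^ (-κ))) atTop (𝓝 0) := by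
    simpa using ((tendsto_rpow_neg_atTop hκ).const_mul C).const_mul 2
  obtain ⟨R₁, hR₁⟩ := eventually_atTop.1
    (hlim.eventually_le_const (show 0 < ε * ρ / 2 by positivity))
  refine ⟨ε, R₁, hε0, fun R hR hR1 u hu hrec h0 => ?_⟩
  have hR0 : 0 < R := by linarith
  have key : ∀ k : ℕ, u (40 ^ k * R) ≤ ε * ρ ^ k := by
    intro k
    induction k with
    | zero => simpa using h0
    | succ k ih =>
      have h40 : (1 : ℝ) ≤ 40 ^ k := one_le_pow₀ (by norm_num)
      have h1 := hrec (40 ^ k * R) (by nlinarith)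
      have e1 : 20 * ((2 : ℕ) : ℝ) * (40 ^ k * R) = 40 ^ (k + 1) * R := by push_cast; ring
      have e2 : ((40 : ℝ) ^ k * R) ^ (-κ) = ρ ^ k * R ^ (-κ) :=
        pow_mul_rpow_neg (by norm_num) hR0 κ k
      beta_reduce at h1
      rw [e1, e2] at h1
      have hρk : 0 < ρ ^ k := by positivity
      have hρk1 : ρ ^ k ≤ 1 := pow_le_one₀ hρ0.le hρ1
      have h2 : (K * u (40 ^ k * R)) ^ 2 ≤ (K * (ε * ρ ^ k)) ^ 2 := by
        have := hu (40 ^ k * R)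
        gcongr
      have h3 : (K * (ε * ρ ^ k)) ^ 2 ≤ ρ / 2 * ε * ρ ^ k := by
        calc (K * (ε * ρ ^ k)) ^ 2 = (K ^ 2 * ε) * ε * ρ ^ k * ρ ^ k := by ring
          _ ≤ ρ / 2 * ε * ρ ^ k * 1 := by gcongr
          _ = _ := by ring
      have h4 : ((2 : ℕ) : ℝ) * (C * (ρ ^ k * R ^ (-κ))) ≤ ε * ρ / 2 * ρ ^ k := by
        calc ((2 : ℕ) : ℝ) * (C * (ρ ^ k * R ^ (-κ))) = 2 * (C * R ^ (-κ)) * ρ ^ k := by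
              push_cast; ring
          _ ≤ _ := mul_le_mul_of_nonneg_right (hR₁ R hR) hρk.le
      calc u (40 ^ (k + 1) * R) ≤ ρ / 2 * ε * ρ ^ k + ε * ρ / 2 * ρ ^ k :=
            h1.trans (add_le_add (h2.trans h3) h4)
        _ = ε * ρ ^ (k + 1) := by ring
  refine ⟨ε * R ^ κ, by positivity, fun k => ?_⟩
  have e0 : (20 * ((2 : ℕ) : ℝ)) = 40 := by norm_num
  simp only [e0]
  refine (key k).trans (le_of_eq ?_)
  have e2 : ((40 : ℝ) ^ k * R) ^ (-κ) = ρ ^ k * R ^ (-κ) :=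
    pow_mul_rpow_neg (by norm_num) hR0 κ k
  rw [e2, Real.rpow_neg hR0.le]
  field_simp

lemma exists_rpow_le_nat {γ : ℝ} (hγ1 : γ < 1) :
    ∃ N : ℕ, 2 ≤ N ∧ (20 * N : ℝ) ^ γ ≤ N := by
  have h1 : Tendsto (fun n : ℕ => (n : ℝ) ^ (1 - γ)) atTop atTop :=
    (tendsto_rpow_atTop (by linarith)).comp tendsto_natCast_atTop_atTop
  obtain ⟨N, hN, hN2⟩ := ((h1.eventually_ge_atTop ((20 : ℝ) ^ γ)).and
    (eventually_ge_atTop 2)).exists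
  have hN0 : (0 : ℝ) < N := by exact_mod_cast (by omega : 0 < N)
  refine ⟨N, hN2, ?_⟩
  rw [Real.mul_rpow (by norm_num) hN0.le]
  calc (20 : ℝ) ^ γ * (N : ℝ) ^ γ ≤ (N : ℝ) ^ (1 - γ) * (N : ℝ) ^ γ := by gcongr
    _ = N := by rw [← Real.rpow_add hN0]; simp

/-- Ansatz `u w ≤ ε * exp (-c * w ^ γ)`. The power `N` multiplies the exponent by `N`, while the
change of scale by `l = 20 N` requires only `l ^ γ ≤ N`. -/
lemma propagates_exp {K C c₁ γ : ℝ} {N : ℕ} (hN : 2 ≤ N) (hNγ : (20 * N : ℝ) ^ γ ≤ N)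
    (hK : 0 ≤ K) (hc₁ : 0 < c₁) (hγ : 0 < γ) :
    Propagates N K (fun w => C * Real.exp (-c₁ * w ^ γ))
      fun C r => C * Real.exp (-(1 / C) * r ^ γ) := by
  have hN0 : (2 : ℝ) ≤ N := by exact_mod_cast hN
  set l : ℝ := 20 * N with hl
  have hl1 : 1 ≤ l := by rw [hl]; linarith
  have hlγ : 0 < l ^ γ := by positivity
  set ε : ℝ := 1 / (2 * (K + 1) ^ 2) with hε
  have hε0 : 0 < ε := by positivity
  have hKε : K * ε ≤ 1 := by
    rw [hε, mul_one_div, div_le_one (by positivity)]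
    nlinarith
  have hKε2 : (K * ε) ^ N ≤ ε / 2 := by
    calc (K * ε) ^ N ≤ (K * ε) ^ 2 := pow_le_pow_of_le_one (by positivity) hKε hN
      _ = K ^ 2 * ε * ε := by ring
      _ ≤ 1 / 2 * ε := by
        gcongr
        rw [hε, mul_one_div, div_le_div_iff₀ (by positivity) (by norm_num)]
        nlinarith
      _ = ε / 2 := by ring
  have hlim : Tendsto (fun R : ℝ => N * C * Real.exp (-(c₁ / 2 * R ^ γ))) atTop (𝓝 0) := by
    have h1 : Tendsto (fun R : ℝ => c₁ / 2 * R ^ γ) atTop atTop :=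
      (tendsto_rpow_atTop hγ).const_mul_atTop (by positivity)
    simpa using (Real.tendsto_exp_neg_atTop_nhds_zero.comp h1).const_mul (N * C)
  obtain ⟨R₁, hR₁⟩ := eventually_atTop.1
    (hlim.eventually_le_const (show 0 < ε / 2 by positivity))
  refine ⟨ε * Real.exp (-1), R₁, by positivity, fun R hR hR1 u hu hrec h0 => ?_⟩
  have hR0 : 0 < R := by linarith
  have hRγ : 0 < R ^ γ := by positivity
  -- The first bound on `c` makes half of the error's decay rate sufficient at scale `l w`, the
  -- other half making the prefactor small; the second accommodates the initial value `ε * exp (-1)`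
  -- at `w = R`.
  set c : ℝ := min (c₁ / (2 * l ^ γ)) (1 / R ^ γ) with hc
  have hc0 : 0 < c := lt_min (by positivity) (by positivity)
  have hcl : c * l ^ γ ≤ c₁ / 2 := by
    have := (le_div_iff₀ (by positivity)).1 (min_le_left (c₁ / (2 * l ^ γ)) (1 / R ^ γ))
    rw [← hc] at this
    linarith
  have hcR : c * R ^ γ ≤ 1 := (le_div_iff₀ hRγ).1 (min_le_right _ _)
  have key : ∀ k : ℕ, u (l ^ k * R) ≤ ε * Real.exp (-c * (l ^ k * R) ^ γ) := by
    intro k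
    induction k with
    | zero =>
      refine le_trans (by simpa using h0) (mul_le_mul_of_nonneg_left (Real.exp_le_exp.2 ?_) hε0.le)
      simp only [pow_zero, one_mul]
      linarith
    | succ k ih =>
      have hlk : (1 : ℝ) ≤ l ^ k := one_le_pow₀ hl1
      set w := l ^ k * R with hw
      have hwR : R ≤ w := by rw [hw]; nlinarith
      have hw0 : 0 < w := by linarith
      have hwγ : R ^ γ ≤ w ^ γ := Real.rpow_le_rpow hR0.le hwR hγ.le
      have hwγ0 : 0 < w ^ γ := by positivity
      have h1 := hrec w hwR
      have e1 : l ^ (k + 1) * R = l * w := by rw [hw]; ring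
      rw [e1, Real.mul_rpow (by positivity) hw0.le]
      have h2 : (K * u w) ^ N ≤ ε / 2 * Real.exp (-c * (l ^ γ * w ^ γ)) := by
        calc (K * u w) ^ N ≤ (K * (ε * Real.exp (-c * w ^ γ))) ^ N := by
              have := hu w
              gcongr
          _ = (K * ε) ^ N * Real.exp (N * (-c * w ^ γ)) := by
              rw [Real.exp_nat_mul]; ring
          _ ≤ ε / 2 * Real.exp (-c * (l ^ γ * w ^ γ)) := by
              refine mul_le_mul hKε2 (Real.exp_le_exp.2 ?_) (Real.exp_pos _).le (by positivity)
              have : c * w ^ γ * l ^ γ ≤ c * w ^ γ * N := by gcongr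
              linarith
      have h3 : N * (C * Real.exp (-c₁ * w ^ γ)) ≤
          ε / 2 * Real.exp (-c * (l ^ γ * w ^ γ)) := by
        calc N * (C * Real.exp (-c₁ * w ^ γ))
            = N * C * Real.exp (-(c₁ / 2 * w ^ γ)) * Real.exp (-(c₁ / 2 * w ^ γ)) := by
              rw [mul_assoc _ (Real.exp _), ← Real.exp_add, mul_assoc]
              congr 3; ring
          _ ≤ ε / 2 * Real.exp (-c * (l ^ γ * w ^ γ)) := by
              refine mul_le_mul (hR₁ w (hR.trans hwR)) (Real.exp_le_exp.2 ?_)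
                (Real.exp_pos _).le (by positivity)
              nlinarith
      linarith
  refine ⟨max ε (1 / c), lt_max_of_lt_left hε0, fun k => (key k).trans ?_⟩
  have hm : 0 < max ε (1 / c) := lt_max_of_lt_left hε0
  refine mul_le_mul (le_max_left _ _) (Real.exp_le_exp.2 ?_) (Real.exp_pos _).le hm.le
  have h1 : 1 / max ε (1 / c) ≤ c := by
    rw [div_le_iff₀ hm]
    calc (1 : ℝ) = c * (1 / c) := by field_simp
      _ ≤ c * max ε (1 / c) := by gcongr; exact le_max_right _ _
  have h2 : 0 ≤ (l ^ k * R) ^ γ := by positivity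
  nlinarith

/-! ### Sums of influences over the lattice -/

lemma tsum_lattice_ite_le (d : ℕ) {R : ℝ} (hR : 0 ≤ R) (c : ENNReal) :
    ∑' z : Lattice d, (if ‖z‖ ≤ R then c else 0) ≤ ENNReal.ofReal ((2 * R + 1) ^ d) * c := by
  let B : Finset (Lattice d) := Fintype.piFinset fun _ => Finset.Icc (-(⌊R⌋₊ : ℤ)) ⌊R⌋₊
  have hB : ∀ z ∉ B, (if ‖z‖ ≤ R then c else 0) = 0 := by
    intro z hz
    refine if_neg fun hzR => hz (Fintype.mem_piFinset.2 fun i => Finset.mem_Icc.2 (abs_le.1 ?_))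
    have h1 : ((z i).natAbs : ℝ) ≤ R := by
      rw [Nat.cast_natAbs]
      exact (abs_le_norm z i).trans hzR
    rw [Int.abs_eq_natAbs]
    exact Int.ofNat_le.2 (Nat.le_floor h1)
  rw [tsum_eq_sum hB]
  calc ∑ z ∈ B, (if ‖z‖ ≤ R then c else 0) ≤ ∑ _z ∈ B, c :=
        Finset.sum_le_sum fun z _ => by split_ifs <;> simp
    _ = (B.card : ENNReal) * c := by simp
    _ ≤ ENNReal.ofReal ((2 * R + 1) ^ d) * c := by
        gcongr
        rw [← ENNReal.ofReal_natCast]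
        refine ENNReal.ofReal_le_ofReal ?_
        have hcard : B.card = (2 * ⌊R⌋₊ + 1) ^ d := by
          rw [Fintype.card_piFinset_const, Int.card_Icc]
          congr 1
          omega
        rw [hcard]
        push_cast
        have := Nat.floor_le hR
        gcongr

/-- Dyadic layers: O((2^k w)^d) sites each contribute at most `(2 ^ k * w) ^ (-(κ + d))`, leaving a
geometric series in `2 ^ (-κ)`. The sum over sites consumes the extra `d` in the tail exponent. -/
lemma tsum_lattice_rpow_le (d : ℕ) {κ q w : ℝ} (hκ : 0 < κ) (hq : 0 < q) (hw : 1 ≤ w) :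
    ∑' z : Lattice d, ENNReal.ofReal ((max w (‖z‖ / q)) ^ (-(κ + d))) ≤
      ENNReal.ofReal ((4 * q + 1) ^ d * (1 - 2 ^ (-κ))⁻¹ * w ^ (-κ)) := by
  have hw0 : 0 < w := by linarith
  have h2 : (2 : ℝ) ^ (-κ) < 1 := Real.rpow_lt_one_of_one_lt_of_neg (by norm_num) (by linarith)
  have h20 : (0 : ℝ) < 2 ^ (-κ) := by positivity
  let g : ℕ → Lattice d → ENNReal := fun k z =>
    if ‖z‖ ≤ q * (2 ^ (k + 1) * w) then ENNReal.ofReal ((2 ^ k * w) ^ (-(κ + d))) else 0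
  have hg : ∀ z : Lattice d,
      ENNReal.ofReal ((max w (‖z‖ / q)) ^ (-(κ + d))) ≤ ∑' k, g k z := by
    intro z
    obtain ⟨k, hk, hk'⟩ := exists_nat_pow_near
      ((one_le_div hw0).2 (le_max_left w (‖z‖ / q))) (one_lt_two (α := ℝ))
    rw [le_div_iff₀ hw0] at hk
    rw [div_lt_iff₀ hw0] at hk'
    have hz : ‖z‖ ≤ q * (2 ^ (k + 1) * w) := by
      have := (le_max_right w (‖z‖ / q)).trans hk'.le
      rwa [div_le_iff₀ hq, mul_comm] at this
    refine le_trans ?_ (ENNReal.le_tsum k)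
    simp only [g, if_pos hz]
    exact ENNReal.ofReal_le_ofReal
      (Real.rpow_le_rpow_of_nonpos (by positivity) hk (by linarith [d.cast_nonneg (α := ℝ)]))
  have hsum : ∀ k, ∑' z, g k z ≤
      ENNReal.ofReal ((4 * q + 1) ^ d * w ^ (-κ) * (2 ^ (-κ)) ^ k) := by
    intro k
    refine (tsum_lattice_ite_le d (by positivity) _).trans ?_
    rw [← ENNReal.ofReal_mul (by positivity)]
    refine ENNReal.ofReal_le_ofReal ?_
    have hk : (1 : ℝ) ≤ 2 ^ k := one_le_pow₀ (by norm_num)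
    have hkw : 1 ≤ 2 ^ k * w := by nlinarith
    have e1 : 2 * (q * (2 ^ (k + 1) * w)) + 1 ≤ (4 * q + 1) * (2 ^ k * w) := by
      rw [pow_succ]; nlinarith
    calc (2 * (q * (2 ^ (k + 1) * w)) + 1) ^ d * (2 ^ k * w) ^ (-(κ + d))
        ≤ ((4 * q + 1) * (2 ^ k * w)) ^ d * (2 ^ k * w) ^ (-(κ + d)) := by gcongr
      _ = (4 * q + 1) ^ d * (2 ^ k * w) ^ (-κ) := by
          rw [mul_pow, neg_add, Real.rpow_add (by positivity), Real.rpow_neg _ (d : ℝ),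
            Real.rpow_natCast]
          · field_simp
          · positivity
      _ = (4 * q + 1) ^ d * w ^ (-κ) * (2 ^ (-κ)) ^ k := by
          rw [pow_mul_rpow_neg two_pos hw0]
          ring
  calc _ ≤ ∑' z, ∑' k, g k z := ENNReal.tsum_le_tsum hg
    _ = ∑' k, ∑' z, g k z := ENNReal.tsum_comm
    _ ≤ ∑' k, ENNReal.ofReal ((4 * q + 1) ^ d * w ^ (-κ) * (2 ^ (-κ)) ^ k) :=
        ENNReal.tsum_le_tsum hsum
    _ = _ := by
        rw [← ENNReal.ofReal_tsum_of_nonneg (fun k => by positivity)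
          ((summable_geometric_of_lt_one h20.le h2).mul_left _), tsum_mul_left,
          tsum_geometric_of_lt_one h20.le h2]
        congr 1
        ring

lemma influenceSum_rpow_le (d : ℕ) {N : ℕ} (hN : 1 ≤ N) {κ C₀ : ℝ} (hκ : 0 < κ) (hC₀ : 0 < C₀) :
    ∃ C, 0 ≤ C ∧ ∀ w, 1 ≤ w →
      influenceSum d N (fun r => C₀ * r ^ (-(κ + d))) w ≤ ENNReal.ofReal (C * w ^ (-κ)) := by
  have hN0 : (0 : ℝ) < N := by exact_mod_cast hN
  have h2 : (2 : ℝ) ^ (-κ) < 1 := Real.rpow_lt_one_of_one_lt_of_neg (by norm_num) (by linarith)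
  have h3 : 0 < (1 - (2 : ℝ) ^ (-κ))⁻¹ := inv_pos.2 (by linarith)
  refine ⟨C₀ * ((4 * (41 * N) + 1) ^ d * (1 - 2 ^ (-κ))⁻¹), by positivity, fun w hw => ?_⟩
  simp only [influenceSum, ENNReal.ofReal_mul hC₀.le, ENNReal.tsum_mul_left]
  rw [mul_assoc C₀, ENNReal.ofReal_mul hC₀.le]
  gcongr
  exact tsum_lattice_rpow_le d hκ (by positivity) hw

lemma exp_neg_le_rpow {c γ p : ℝ} (hc : 0 < c) (hγ : 0 < γ) (hp : 0 < p) :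
    ∃ A, 0 < A ∧ ∀ r, 0 < r → Real.exp (-c * r ^ γ) ≤ A * r ^ (-p) := by
  set s := p / γ with hs
  have hs0 : 0 < s := by positivity
  refine ⟨(c / s) ^ (-s), by positivity, fun r hr => ?_⟩
  have hy : 0 < c / s * r ^ γ := by positivity
  have h1 : c / s * r ^ γ ≤ Real.exp (c / s * r ^ γ) := by
    linarith [Real.add_one_le_exp (c / s * r ^ γ)]
  calc Real.exp (-c * r ^ γ) = (Real.exp (c / s * r ^ γ)) ^ (-s) := by
        rw [← Real.exp_mul]
        congr 1
        field_simp
    _ ≤ (c / s * r ^ γ) ^ (-s) := Real.rpow_le_rpow_of_nonpos hy h1 (by linarith)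
    _ = (c / s) ^ (-s) * r ^ (-p) := by
        rw [Real.mul_rpow (by positivity) (by positivity), ← Real.rpow_mul hr.le]
        congr 2
        rw [hs]
        field_simp

/-- The exponent is split in two halves. One is evaluated at `w` and taken out of the sum; the other
is dominated by the power `-(1 + d)`, which is summable. -/
lemma influenceSum_exp_le (d : ℕ) {N : ℕ} (hN : 1 ≤ N) {γ C₀ : ℝ} (hγ : 0 < γ) (hC₀ : 0 < C₀) :
    ∃ C, 0 ≤ C ∧ ∀ w, 1 ≤ w →
      influenceSum d N (fun r => C₀ * Real.exp (-(1 / C₀) * r ^ γ)) w ≤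
        ENNReal.ofReal (C * Real.exp (-(1 / (2 * C₀)) * w ^ γ)) := by
  obtain ⟨A, hA, hA'⟩ := exp_neg_le_rpow (c := 1 / (2 * C₀)) (p := 1 + d) (by positivity) hγ
    (by positivity)
  obtain ⟨C, hC, hC'⟩ := influenceSum_rpow_le d hN zero_lt_one (mul_pos hC₀ hA)
  refine ⟨C, hC, fun w hw => ?_⟩
  have hw0 : 0 < w := by linarith
  set e := Real.exp (-(1 / (2 * C₀)) * w ^ γ) with he
  have he0 : 0 < e := Real.exp_pos _
  have hterm : ∀ r, w ≤ r → C₀ * Real.exp (-(1 / C₀) * r ^ γ) ≤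
      e * (C₀ * A * r ^ (-(1 + d : ℝ))) := by
    intro r hr
    have h1 : w ^ γ ≤ r ^ γ := Real.rpow_le_rpow hw0.le hr hγ.le
    have h2 : Real.exp (-(1 / C₀) * r ^ γ) =
        Real.exp (-(1 / (2 * C₀)) * r ^ γ) * Real.exp (-(1 / (2 * C₀)) * r ^ γ) := by
      rw [← Real.exp_add]
      congr 1
      field_simp
      ring
    have h3 : Real.exp (-(1 / (2 * C₀)) * r ^ γ) ≤ e := by
      refine Real.exp_le_exp.2 ?_
      have : 0 < 1 / (2 * C₀) := by positivity
      nlinarith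
    rw [h2]
    calc C₀ * (Real.exp (-(1 / (2 * C₀)) * r ^ γ) * Real.exp (-(1 / (2 * C₀)) * r ^ γ))
        ≤ C₀ * (e * (A * r ^ (-(1 + d : ℝ)))) := by
          gcongr
          exact hA' r (by linarith)
      _ = _ := by ring
  calc influenceSum d N (fun r => C₀ * Real.exp (-(1 / C₀) * r ^ γ)) w
      ≤ ENNReal.ofReal e * influenceSum d N (fun r => C₀ * A * r ^ (-(1 + d : ℝ))) w := by
        rw [influenceSum, influenceSum, ← ENNReal.tsum_mul_left]
        refine ENNReal.tsum_le_tsum fun z => ?_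
        rw [← ENNReal.ofReal_mul he0.le]
        exact ENNReal.ofReal_le_ofReal (hterm _ (le_max_left _ _))
    _ ≤ ENNReal.ofReal e * ENNReal.ofReal (C * w ^ (-1 : ℝ)) := by
        gcongr
        exact hC' w hw
    _ ≤ ENNReal.ofReal (C * e) := by
        rw [← ENNReal.ofReal_mul he0.le, mul_comm C e]
        refine ENNReal.ofReal_le_ofReal (mul_le_mul_of_nonneg_left ?_ he0.le)
        have : w ^ (-1 : ℝ) ≤ 1 := Real.rpow_le_one_of_one_le_of_nonpos hw (by norm_num)
        nlinarith

/-! ### Assembly of the estimates -/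

section

variable {Ω : Type u} [MeasurableSpace Ω] {P : Measure Ω} [IsProbabilityMeasure P]
  {𝓘 : InclusionProcess d P} {tail err : ℝ → ℝ} {ψ : ℝ → ℝ → ℝ} {N : ℕ}

/-- If crossings are unlikely at some large scale, then large clusters are as unlikely as large
action radii. -/
lemma HasActionRadii.exists_clusterTail_le (h : HasActionRadii.{u, v} 𝓘 tail)
    (hH : ConditionH 𝓘) (hd : 1 ≤ d) (hN : 1 ≤ N) (hψ : TailFamily ψ)
    (herr : ∀ w, 1 ≤ w → 0 ≤ err w ∧ influenceSum d N tail w ≤ ENNReal.ofReal (err w))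
    {ε R₁ : ℝ} (hε : 0 < ε)
    (hprop : ∀ R, R₁ ≤ R → 1 ≤ R → ∀ u : ℝ → ℝ, (∀ w, 0 ≤ u w) →
      (∀ w, R ≤ w → u (20 * N * w) ≤ ((80 * N + 1 : ℝ) ^ d * u w) ^ N + N * err w) → u R ≤ ε →
      ∃ A, 0 < A ∧ ∀ k : ℕ, u ((20 * N) ^ k * R) ≤ ψ A ((20 * N) ^ k * R))
    {t R : ℝ} (ht : 0 < t) (hR₁ : R₁ ≤ R) (hR : 1 ≤ R) (htR : t ≤ R)
    (hcross : P.real {ω | 𝓘.total ω ∈ crossing t 0 R} ≤ ε) :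
    ∃ C, 0 < C ∧ ∀ r, 0 < r → 𝓘.clusterTail (t / 2) r ≤ ψ C r := by
  have hN' : (1 : ℝ) ≤ N := by exact_mod_cast hN
  have hd' : (1 : ℝ) ≤ d := by exact_mod_cast hd
  obtain ⟨A, hA, hA'⟩ := hprop R hR₁ hR (fun w => P.real {ω | 𝓘.total ω ∈ crossing t 0 w})
    (fun w => measureReal_nonneg)
    (fun w hw => (renormalizable_crossing N ht).measureReal_renorm_le hH h hN (by linarith)
      (by linarith) (herr w (by linarith)).1 (herr w (by linarith)).2) hcross
  -- The starting scale for vacancy depends on the process. This affects only the final constant,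
  -- not the threshold on `L`.
  obtain ⟨R', hR', hvac⟩ := 𝓘.exists_vacant_le hH hε (max R₁ 1)
  have hR'1 : 1 ≤ R' := (le_max_right _ _).trans hR'
  obtain ⟨B, hB, hB'⟩ := hprop R' ((le_max_left _ _).trans hR') hR'1
    (fun w => P.real {ω | 𝓘.total ω ∈ vacant 0 w}) (fun w => measureReal_nonneg)
    (fun w hw => (renormalizable_vacant hd N).measureReal_renorm_le hH h hN (by linarith)
      (by linarith) (herr w (by linarith)).1 (herr w (by linarith)).2) hvac
  obtain ⟨B₁, hB₁, hB₁'⟩ := hψ.of_geometric (g := fun w => P.real {ω | 𝓘.total ω ∈ vacant 0 w})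
    (fun w w' hww' => measureReal_mono fun ω hω p hp => by linarith [hω p hp])
    (fun w => measureReal_le_one) (l := 20 * N) (by linarith) (by linarith) hB hB'
  obtain ⟨A₂, hA₂, hA₂'⟩ := hψ.scale A (1 / (6 * d)) hA (by positivity)
  obtain ⟨B₂, hB₂, hB₂'⟩ := hψ.scale B₁ (1 / (24 * d ^ 2)) hB₁ (by positivity)
  obtain ⟨C, hC, hC'⟩ := hψ.add A₂ B₂ hA₂ hB₂
  refine hψ.of_geometric (𝓘.clusterTail_antitone (t / 2)) (fun r => measureReal_le_one)
    (l := 20 * N) (R := 6 * d * R) (by linarith) (by positivity) hC fun k => ?_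
  have hl : (1 : ℝ) ≤ (20 * N) ^ k := one_le_pow₀ (by linarith)
  set w : ℝ := (20 * N) ^ k * R with hw
  have hwR : R ≤ w := by rw [hw]; nlinarith
  have hw0 : 0 < w := by linarith
  have e : (20 * N : ℝ) ^ k * (6 * d * R) = 6 * d * w := by rw [hw]; ring
  rw [e]
  have hr : 0 < 6 * d * w := by positivity
  have e1 : 1 / (6 * d) * (6 * d * w) = w := by field_simp
  have e2 : 1 / (24 * (d : ℝ) ^ 2) * (6 * d * w) = w / (4 * d) := by field_simp; norm_num
  have h1 := hA₂' _ hr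
  have h2 := hB₂' _ hr
  rw [e1] at h1
  rw [e2] at h2
  have h3 := 𝓘.clusterTail_le hd hw0 (htR.trans hwR) (le_refl (6 * d * w))
  have h4 := hA' k
  have h5 := hB₁' (w / (4 * d)) (by positivity)
  linarith [hC' _ hr]

end

/-- The percolation threshold, uniformly over the inclusion processes. -/
lemma Propagates.exists_threshold (hd : 1 ≤ d) {tail err : ℝ → ℝ} {ψ : ℝ → ℝ → ℝ} {N : ℕ}
    (hN : 1 ≤ N) (hψ : TailFamily ψ)
    (herr : ∀ w, 1 ≤ w → 0 ≤ err w ∧ influenceSum d N tail w ≤ ENNReal.ofReal (err w))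
    (hprop : Propagates N ((80 * N + 1 : ℝ) ^ d) err ψ) {Λ : ℝ} (hΛ : 1 ≤ Λ) :
    ∃ L₀ : ℝ, ∀ (Ω : Type u) [MeasurableSpace Ω] (P : Measure Ω) [IsProbabilityMeasure P]
      (𝓘 : InclusionProcess d P), ConditionH 𝓘 → HasActionRadii.{u, v} 𝓘 tail →
      ∀ L t r₀ : ℝ, 1 ≤ L → L₀ ≤ L → 0 < t → t ≤ Λ → 1 / Λ ≤ r₀ →
      (∀ m : ℝ, 20 * Λ ^ 2 ≤ m → P.real {ω | 𝓘.total ω ∈ crossing t 0 (m * r₀)} ≤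
        2 * shellConst d * m ^ (d - 1) * Λ / L) →
      ∃ C, 0 < C ∧ ∀ r, 0 < r → 𝓘.clusterTail (t / 2) r ≤ ψ C r := by
  obtain ⟨ε, R₁, hε, hprop⟩ := hprop
  -- Since `r₀ ≥ 1 / Λ`, this `m` gives `m * r₀ ≥ max R₁ Λ`, so the initial scale exceeds `R₁`, 1
  -- and `t`. As `r₀` may be large, the recursion has to start from any such scale with the same
  -- `ε`; the threshold then makes the crossing bound at most `ε`.
  set m : ℝ := max (20 * Λ ^ 2) (Λ * max R₁ Λ) with hm
  refine ⟨2 * shellConst d * m ^ (d - 1) * Λ / ε, ?_⟩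
  intro Ω _ P _ 𝓘 hH h L t r₀ hL hL₀ ht htΛ hr₀ hcross
  have hΛ0 : 0 < Λ := by linarith
  have hm0 : 0 ≤ m := le_max_of_le_left (by positivity)
  have hR : max R₁ Λ ≤ m * r₀ := by
    calc max R₁ Λ = Λ * max R₁ Λ * (1 / Λ) := by field_simp
      _ ≤ m * (1 / Λ) := by gcongr; exact le_max_right _ _
      _ ≤ m * r₀ := by gcongr
  have hRΛ : Λ ≤ m * r₀ := (le_max_right _ _).trans hR
  refine h.exists_clusterTail_le hH hd hN hψ herr hε hprop ht ((le_max_left _ _).trans hR)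
    (by linarith) (by linarith) ((hcross m (le_max_left _ _)).trans ?_)
  rw [div_le_iff₀ (by linarith)]
  rw [div_le_iff₀ hε] at hL₀
  linarith

end ContinuumPercolation

end

theorem theorem1 (d : ℕ) (hd : 1 ≤ d) :
    (∃ L₀ : ℝ → ℝ → ℝ → ℝ,
      ∀ (Ω : Type u) [MeasurableSpace Ω] (P : Measure Ω) [IsProbabilityMeasure P]
        (𝓘 : ContinuumPercolation.InclusionProcess d P),
        ContinuumPercolation.ConditionH 𝓘 →
        ∀ Λ L : ℝ, 1 ≤ Λ → 1 ≤ L → ContinuumPercolation.ConditionPerc 𝓘 Λ L →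
        ∃ ρ : ℝ, 0 < ρ ∧
          ∀ κ C₀ : ℝ, 0 < κ → 0 < C₀ → L₀ Λ κ C₀ ≤ L →
            ContinuumPercolation.HasActionRadii.{u, v} 𝓘
              (fun r => C₀ * r ^ (-(κ + (d : ℝ)))) →
            ∃ C₁ : ℝ, 0 < C₁ ∧ ∀ r : ℝ, 0 < r → 𝓘.clusterTail ρ r ≤ C₁ * r ^ (-κ)) ∧
    (∃ L₀ : ℝ → ℝ → ℝ → ℝ,
      ∀ (Ω : Type u) [MeasurableSpace Ω] (P : Measure Ω) [IsProbabilityMeasure P]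
        (𝓘 : ContinuumPercolation.InclusionProcess d P),
        ContinuumPercolation.ConditionH 𝓘 →
        ∀ γ C₀ : ℝ, 0 < γ → γ < 1 → 0 < C₀ →
          ContinuumPercolation.HasActionRadii.{u, v} 𝓘
            (fun r => C₀ * Real.exp (-(1 / C₀) * r ^ γ)) →
          ∀ Λ L : ℝ, 1 ≤ Λ → L₀ Λ γ C₀ ≤ L → 1 ≤ L →
            ContinuumPercolation.ConditionPerc 𝓘 Λ L →
            ∃ ρ Cγ : ℝ, 0 < ρ ∧ 0 < Cγ ∧
              ∀ r : ℝ, 0 < r →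
                𝓘.clusterTail ρ r ≤ Cγ * Real.exp (-(1 / Cγ) * r ^ γ)) := by
  open ContinuumPercolation in
  have poly : ∀ Λ κ C₀ : ℝ, ∃ L₀ : ℝ, 1 ≤ Λ → 0 < κ → 0 < C₀ →
      ∀ (Ω : Type u) [MeasurableSpace Ω] (P : Measure Ω) [IsProbabilityMeasure P]
      (𝓘 : InclusionProcess d P), ConditionH 𝓘 →
      HasActionRadii.{u, v} 𝓘 (fun r => C₀ * r ^ (-(κ + (d : ℝ)))) →
      ∀ L t r₀ : ℝ, 1 ≤ L → L₀ ≤ L → 0 < t → t ≤ Λ → 1 / Λ ≤ r₀ →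
      (∀ m : ℝ, 20 * Λ ^ 2 ≤ m → P.real {ω | 𝓘.total ω ∈ crossing t 0 (m * r₀)} ≤
        2 * shellConst d * m ^ (d - 1) * Λ / L) →
      ∃ C, 0 < C ∧ ∀ r, 0 < r → 𝓘.clusterTail (t / 2) r ≤ C * r ^ (-κ) := by
    intro Λ κ C₀
    -- The threshold is a total function of its parameters; it takes the value 0 outside the
    -- admissible range.
    by_cases hp : 1 ≤ Λ ∧ 0 < κ ∧ 0 < C₀
    · obtain ⟨hΛ, hκ, hC₀⟩ := hp
      obtain ⟨C, hC, hsum⟩ := influenceSum_rpow_le d one_le_two hκ hC₀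
      obtain ⟨L₀, hL₀⟩ := (propagates_rpow (K := (80 * (2 : ℕ) + 1 : ℝ) ^ d) (by positivity)
        hκ).exists_threshold hd one_le_two (tailFamily_rpow hκ)
        (fun w hw => ⟨by positivity, hsum w hw⟩) hΛ
      exact ⟨L₀, fun _ _ _ => hL₀⟩
    · exact ⟨0, fun h1 h2 h3 => absurd ⟨h1, h2, h3⟩ hp⟩
  open ContinuumPercolation in
  have expo : ∀ Λ γ C₀ : ℝ, ∃ L₀ : ℝ, 1 ≤ Λ → 0 < γ → γ < 1 → 0 < C₀ →
      ∀ (Ω : Type u) [MeasurableSpace Ω] (P : Measure Ω) [IsProbabilityMeasure P]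
      (𝓘 : InclusionProcess d P), ConditionH 𝓘 →
      HasActionRadii.{u, v} 𝓘 (fun r => C₀ * Real.exp (-(1 / C₀) * r ^ γ)) →
      ∀ L t r₀ : ℝ, 1 ≤ L → L₀ ≤ L → 0 < t → t ≤ Λ → 1 / Λ ≤ r₀ →
      (∀ m : ℝ, 20 * Λ ^ 2 ≤ m → P.real {ω | 𝓘.total ω ∈ crossing t 0 (m * r₀)} ≤
        2 * shellConst d * m ^ (d - 1) * Λ / L) →
      ∃ C, 0 < C ∧ ∀ r, 0 < r →
        𝓘.clusterTail (t / 2) r ≤ C * Real.exp (-(1 / C) * r ^ γ) := by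
    intro Λ γ C₀
    by_cases hp : 1 ≤ Λ ∧ 0 < γ ∧ γ < 1 ∧ 0 < C₀
    · obtain ⟨hΛ, hγ, hγ1, hC₀⟩ := hp
      obtain ⟨N, hN, hNγ⟩ := exists_rpow_le_nat hγ1
      obtain ⟨C, hC, hsum⟩ := influenceSum_exp_le d (N := N) (by omega) hγ hC₀
      obtain ⟨L₀, hL₀⟩ := (propagates_exp (K := (80 * N + 1 : ℝ) ^ d) (C := C) hN hNγ
        (by positivity) (show 0 < 1 / (2 * C₀) by positivity) hγ).exists_threshold hd (by omega)
        (tailFamily_exp hγ) (fun w hw => ⟨by positivity, hsum w hw⟩) hΛ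
      exact ⟨L₀, fun _ _ _ _ => hL₀⟩
    · exact ⟨0, fun h1 h2 h3 h4 => absurd ⟨h1, h2, h3, h4⟩ hp⟩
  choose L₀ hL₀ using poly
  choose L₁ hL₁ using expo
  refine ⟨⟨L₀, ?_⟩, ⟨L₁, ?_⟩⟩
  · intro Ω _ P _ 𝓘 hH Λ L hΛ hL hP
    obtain ⟨t, r₀, ht, htΛ, hr₀, hcross⟩ := 𝓘.exists_crossing_le hH hd hΛ hL hP
    -- `t` comes from the percolation condition alone, so `ρ` is fixed before `κ` and `C₀`.
    exact ⟨t / 2, by positivity, fun κ C₀ hκ hC₀ hLL h =>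
      hL₀ Λ κ C₀ hΛ hκ hC₀ Ω P 𝓘 hH h L t r₀ hL hLL ht htΛ hr₀ hcross⟩
  · intro Ω _ P _ 𝓘 hH γ C₀ hγ hγ1 hC₀ h Λ L hΛ hLL hL hP
    obtain ⟨t, r₀, ht, htΛ, hr₀, hcross⟩ := 𝓘.exists_crossing_le hH hd hΛ hL hP
    obtain ⟨C, hC, hC'⟩ :=
      hL₁ Λ γ C₀ hΛ hγ hγ1 hC₀ Ω P 𝓘 hH h L t r₀ hL hLL ht htΛ hr₀ hcross
    exact ⟨t / 2, C, by positivity, hC, hC'⟩
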